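/- **Setting.** Let $K=\min\{n_T,n_R\}$ and consider $N$ channel uses. The symbols $s_n\in\mathbb R^K$ are i.i.d. along the channel uses, with independent components and $\mathbb E\{s_ns_n^{T}\}=I_K$, and arbitrary distribution otherwise; the noise $w_n\sim\mathcal N(0,I_{n_R})$ is independent of $s_n$, and different channel uses are independent. The channel matrix $H_n\in\mathbb R^{n_R\times n_T}$ has rank $K$ and thin singular value decomposition $H_n=V_{H_n}\Lambda_nU_{H_n}^{T}$ ($\Lambda_n$ diagonal with nonnegative entries, $V_{H_n}^TV_{H_n}=U_{H_n}^TU_{H_n}=I_K$), and $V_n\in\mathbb R^{K\times K}$ is orthogonal. For $p_n=(\sigma_{1,n}^2,\dots,\sigma_{K,n}^2)^T$, the vector of squared singular values of the precoder $U_{H_n}\Delta_nV_n^T$ with $\Delta_n=\mathrm{Diag}(\sigma_{1,n},\dots,\sigma_{K,n})$, let $\tilde H_n=V_{H_n}\Lambda_n\Delta_nV_n^{T}$ and $y_n=\tilde H_ns_n+w_n$. Let $I(s_n;\tilde H_ns_n+w_n)$ be the mutual information in nats and $E_n=\mathbb E\{(s_n-\hat s_n)(s_n-\hat s_n)^T\}$,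 $\hat s_n=\mathbb E\{s_n\mid y_n\}$, the MMSE matrix. Packets of energy $\mathcal E_1,\dots,\mathcal E_J\ge 0$, $J\ge1$, arrive at the beginning of the channel uses $1=e_1<\dots<e_J\le N$; the pool $\tau_j$ is the set of channel uses from $e_j$ up to, but not including, $e_{j+1}$ (up to $N$ if $j=J$). With symbol duration $T_s>0$, the energy causality constraints are $T_s\sum_{j=1}^{\ell}\sum_{n\in\tau_j}\mathbf 1^Tp_n\le\sum_{j=1}^{\ell}\mathcal E_j$, $\ell=1,\dots,J$. For multipliers $\rho_1,\dots,\rho_J$ let $$\mathcal L=\sum_{j=1}^J\sum_{n\in\tau_j}I(s_n;\tilde H_ns_n+w_n)-\sum_{\ell=1}^J\rho_\ell\Big(T_s\sum_{j=1}^{\ell}\sum_{n\in\tau_j}\mathbf 1^Tp_n-\sum_{j=1}^{\ell}\mathcal E_j\Big),\qquad W_j=\frac1{2T_s\sum_{\ell=j}^J\rho_\ell},$$ where $1/W_j$ is read as $0$ if $\sum_{\ell\ge j}\rho_\ell=0$. **Claim.** (1) For every $n$ and every $p_n\ge0$ (componentwise), the mutual information is finite and differentiable with respect to $p_n$, with Jacobian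 $$\mathsf D_{p_n}I(s_n;\tilde H_ns_n+w_n)=\tfrac12\,\mathrm{diag}^T\!\big(\Lambda_n^2V_n^TE_nV_n\big).$$ If some component of $p_n$ vanishes, the derivative is the one relative to the nonnegative orthant; if all components are positive, it is the usual derivative. (2) For all real multipliers $\rho$, every $p=(p_1,\dots,p_N)$ with nonnegative entries, every $j$ and every $n\in\tau_j$, the condition $\mathsf D_{p_n}\mathcal L=0$ at $p$ (derivative in $p_n$ relative to the nonnegative orthant) holds if and only if $$[\Lambda_n^2V_n^TE_nV_n]_{kk}=\frac1{W_j},\qquad k=1,\dots,K.$$ (3) If $p$ maximizes $\sum_j\sum_{n\in\tau_j}I(s_n;\tilde H_ns_n+w_n)$ over all nonnegative allocations that satisfy the energy causality constraints, then there are $\rho_1,\dots,\rho_J\ge0$ with $\rho_\ell\big(T_s\sum_{j\le\ell}\sum_{n\in\tau_j}\mathbf 1^Tp_n-\sum_{j\le\ell}\mathcal E_j\big)=0$ for all $\ell$, such that for all $j$, $n\in\tau_j$ and $k$: $[\Lambda_n^2V_n^TE_nV_n]_{kk}\le 1/W_j$, with equality whenever $\sigma_{k,n}^2>0$. -/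

import Mathlib

open MeasureTheory ProbabilityTheory
open scoped Matrix ENNReal

noncomputable section

/-! ### Mutual information and the MMSE matrix -/

/-- The mutual information `I(X; Y)` in nats: the Kullback-Leibler divergence of the joint law
of `(X, Y)` from the product of the two marginal laws. -/
def mutualInfo {Ω α β : Type*} [MeasurableSpace Ω] [MeasurableSpace α] [MeasurableSpace β]
    (P : Measure Ω) (X : Ω → α) (Y : Ω → β) : ℝ≥0∞ :=
  InformationTheory.klDiv (P.map fun ω => (X ω, Y ω)) ((P.map X).prod (P.map Y))

/-- The `i`-th component of the conditional mean estimator `E[X | Y]` of the vector `X`. -/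
def condMean {Ω ι β : Type*} [MeasurableSpace Ω] [MeasurableSpace β]
    (P : Measure Ω) (X : Ω → ι → ℝ) (Y : Ω → β) (i : ι) : Ω → ℝ :=
  P[fun ω => X ω i | MeasurableSpace.comap Y inferInstance]

/-- The MMSE matrix `E[(X - X̂) (X - X̂)ᵀ]`, where `X̂ = E[X | Y]`. -/
def mmseMatrix {Ω ι β : Type*} [MeasurableSpace Ω] [MeasurableSpace β]
    (P : Measure Ω) (X : Ω → ι → ℝ) (Y : Ω → β) : Matrix ι ι ℝ :=
  Matrix.of fun i j =>
    ∫ ω, (X ω i - condMean P X Y i ω) * (X ω j - condMean P X Y j ω) ∂P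

/-! ### The linear vector Gaussian channel -/

/-- Symbols `S n` and noises `W n` over the channel uses `n`: the symbols are i.i.d. along the
channel uses, each with independent components and `E[s sᵀ] = I`; each noise is `N(0, I)` and
independent of the symbol; different channel uses are independent. Square integrability of the
components of the symbols is a consequence of `second_moment` (on the diagonal the Bochner
integral is nonzero). -/
structure IsSymbolNoiseModel {Ω : Type*} [MeasurableSpace Ω] {N K nR : ℕ} (P : Measure Ω)
    (S : Fin N → Ω → Fin K → ℝ) (W : Fin N → Ω → Fin nR → ℝ) : Prop where
  measurable_symbol : ∀ n, Measurable (S n)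
  measurable_noise : ∀ n, Measurable (W n)
  indep_uses : iIndepFun (fun n ω => (S n ω, W n ω)) P
  identDistrib_symbol : ∀ n m, IdentDistrib (S n) (S m) P P
  indep_components : ∀ n, iIndepFun (fun k ω => S n ω k) P
  second_moment : ∀ n k l, ∫ ω, S n ω k * S n ω l ∂P = if k = l then 1 else 0
  noise_law : ∀ n, P.map (W n) = Measure.pi fun _ => gaussianReal 0 1
  indep_noise : ∀ n, IndepFun (S n) (W n) P

/-- `H = V_H Λ U_Hᵀ` is a thin singular value decomposition, with `Λ = Diag(lam)`. -/
structure IsThinSVD {nR nT K : ℕ} (H : Matrix (Fin nR) (Fin nT) ℝ)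
    (VH : Matrix (Fin nR) (Fin K) ℝ) (lam : Fin K → ℝ) (UH : Matrix (Fin nT) (Fin K) ℝ) :
    Prop where
  eq_mul : H = VH * Matrix.diagonal lam * UHᵀ
  left_semiunitary : VHᵀ * VH = 1
  right_semiunitary : UHᵀ * UH = 1
  nonneg : ∀ k, 0 ≤ lam k

/-- The effective channel matrix `H̃ = V_H Λ Δ Vᵀ`, where `Δ = Diag(σ)`, as a function of the
vector `p = (σ₁², …, σ_K²)` of squared singular values of the precoder `U_H Δ Vᵀ`. -/
def effChannel {nR K : ℕ} (VH : Matrix (Fin nR) (Fin K) ℝ) (lam : Fin K → ℝ)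
    (V : Matrix (Fin K) (Fin K) ℝ) (p : Fin K → ℝ) : Matrix (Fin nR) (Fin K) ℝ :=
  VH * Matrix.diagonal lam * Matrix.diagonal (fun k => Real.sqrt (p k)) * Vᵀ

/-- The received signal `H̃ s + w`. -/
def received {Ω : Type*} {nR K : ℕ} (s : Ω → Fin K → ℝ) (w : Ω → Fin nR → ℝ)
    (Ht : Matrix (Fin nR) (Fin K) ℝ) : Ω → Fin nR → ℝ :=
  fun ω => Ht *ᵥ s ω + w ω

/-- The real number `I(s; H̃ s + w)`, as a function of the squared singular values `p`. -/
def rate {Ω : Type*} [MeasurableSpace Ω] {nR K : ℕ} (P : Measure Ω)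
    (s : Ω → Fin K → ℝ) (w : Ω → Fin nR → ℝ) (VH : Matrix (Fin nR) (Fin K) ℝ)
    (lam : Fin K → ℝ) (V : Matrix (Fin K) (Fin K) ℝ) (p : Fin K → ℝ) : ℝ :=
  (mutualInfo P s (received s w (effChannel VH lam V p))).toReal

/-- The matrix `Λ² Vᵀ E V`, where `E` is the MMSE matrix of `s` given `H̃ s + w`. -/
def gainMatrix {Ω : Type*} [MeasurableSpace Ω] {nR K : ℕ} (P : Measure Ω)
    (s : Ω → Fin K → ℝ) (w : Ω → Fin nR → ℝ) (VH : Matrix (Fin nR) (Fin K) ℝ)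
    (lam : Fin K → ℝ) (V : Matrix (Fin K) (Fin K) ℝ) (p : Fin K → ℝ) :
    Matrix (Fin K) (Fin K) ℝ :=
  Matrix.diagonal lam ^ 2 * Vᵀ * mmseMatrix P s (received s w (effChannel VH lam V p)) * V

/-- The `1 × K` Jacobian matrix (row vector) `a`, as a linear map. -/
def rowMap {K : ℕ} (a : Fin K → ℝ) : (Fin K → ℝ) →L[ℝ] ℝ :=
  ∑ k, a k • ContinuousLinearMap.proj (R := ℝ) (φ := fun _ : Fin K => ℝ) k

/-! ### Energy harvesting -/

/-- The `j`-th pool: the channel uses from the `j`-th energy arrival `e j` on, and before the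
next arrival. -/
def pool {J N : ℕ} (e : Fin J → Fin N) (j : Fin J) : Finset (Fin N) :=
  Finset.univ.filter fun n => e j ≤ n ∧ ∀ i, j < i → n < e i

/-- Energy spent up to the end of pool `l`: `Ts ∑_{j ≤ l} ∑_{n ∈ τ_j} 1ᵀ p_n`. -/
def spent {J N K : ℕ} (e : Fin J → Fin N) (Ts : ℝ) (p : Fin N → Fin K → ℝ) (l : Fin J) : ℝ :=
  Ts * ∑ j ∈ Finset.Iic l, ∑ n ∈ pool e j, ∑ k, p n k

/-- Energy harvested up to pool `l`: `∑_{j ≤ l} E_j`. -/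
def harvested {J : ℕ} (E : Fin J → ℝ) (l : Fin J) : ℝ :=
  ∑ j ∈ Finset.Iic l, E j

/-- The power allocations (vectors of squared singular values, one for every channel use) that
satisfy the energy causality constraints. -/
def feasible {J N : ℕ} (K : ℕ) (e : Fin J → Fin N) (Ts : ℝ) (E : Fin J → ℝ) :
    Set (Fin N → Fin K → ℝ) :=
  {p | (∀ n k, 0 ≤ p n k) ∧ ∀ l, spent e Ts p l ≤ harvested E l}

/-- The total rate `∑_j ∑_{n ∈ τ_j} I_n(p_n)`. -/
def totalRate {J N K : ℕ} (e : Fin J → Fin N) (I : Fin N → (Fin K → ℝ) → ℝ)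
    (p : Fin N → Fin K → ℝ) : ℝ :=
  ∑ j, ∑ n ∈ pool e j, I n (p n)

/-- The Lagrangian, with multipliers `ρ` for the energy causality constraints. -/
def lagrangian {J N K : ℕ} (e : Fin J → Fin N) (Ts : ℝ) (E : Fin J → ℝ)
    (I : Fin N → (Fin K → ℝ) → ℝ) (ρ : Fin J → ℝ) (p : Fin N → Fin K → ℝ) : ℝ :=
  totalRate e I p - ∑ l, ρ l * (spent e Ts p l - harvested E l)

/-- The water level `W_j = 1 / (2 Ts ∑_{l ≥ j} ρ_l)` of pool `j`. If the sum vanishes, the water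
level is infinite and `1 / W_j = 0`, which is also the value of `1 / waterLevel Ts ρ j`. -/
def waterLevel {J : ℕ} (Ts : ℝ) (ρ : Fin J → ℝ) (j : Fin J) : ℝ :=
  1 / (2 * Ts * ∑ l ∈ Finset.Ici j, ρ l)

end

/-! The Jacobian. Put `a k = lam k * √(p k)` and `u = Vᵀ s`. The received vector is `VH (a ∘ u) + w`
with `VHᵀ VH = 1`, so only the amplitudes `a` depend on `p`. Given `u`, its law has density `lik`
with respect to the standard Gaussian law `γ`, and its unconditional law has density `Z = evidence`.
The divergence that defines the mutual information is therefore the mean of `log lik - log Z`, that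
is `∑ a_k² / 2 * E[u_k²] - ∫ Z log Z dγ` (`klDiv_channelMap`). Since `E[u_k²] = 1`, the first term
is linear in `p`, and everything reduces to the derivative of `mixEntropy`.

Gaussian integration by parts (`integral_log_evidence_mul_firstMoment`) shows that `∂/∂a_k ∫ Z log Z
dγ = a_k M_k(a)`, where `M_k = estimateEnergy` is the second moment of the posterior mean of `u_k`.
As `a_k² = lam_k² p_k`, the derivative in `p_k` is formally `lam_k² M_k / 2`, so that of the rate is
`lam_k² (1 - M_k) / 2`; and `1 - M_k` is the mean square error of `u_k`, the diagonal entry of `Vᵀ E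
V` (`gainMatrix_diag`).

Two points need care. Only second moments are available, so differentiation under the integral is
done for laws on a cube, and the integrated identity `mixEntropy_sub` is carried to the general law
by exhaustion; continuity of `M_k` then comes from Pratt's lemma. Moreover `√` is not differentiable
at `0`, but the integrand along the segment of amplitudes contains the products `d_k * (a + t d)_k`,
which are controlled by `|q_k - p_k|` up to the boundary (`hasFDerivWithinAt_mixEntropy`).

Stationarity. Power used in pool `j` enters exactly the constraints `l ≥ j`, so the derivative of
the Lagrangian in `p_n` is the Jacobian minus the constant `Ts ∑_{l ≥ j} ρ_l` in every component,
and derivatives relative to the orthant are unique.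

Optimality. No concavity of the rate and no abstract multiplier theorem is used. At a maximizer,
first-order variations show that moving power from a used component to another one, or adding power,
cannot help to first order when the constraints allow the move (`le_mul_of_isMaxOn`). Let `R j` be
the largest marginal rate among the components that energy available in pool `j` can reach without
crossing an active constraint. Then `R` is antitone, constant across inactive constraints and `0` at
the end, and its decrements divided by `2 Ts` are the multipliers (`exists_multipliers`). -/

/-! ### The standard Gaussian measure on `ℝⁿ` -/

/-- The standard Gaussian measure on `Fin n → ℝ`. -/
noncomputable abbrev stdGaussianPi (n : ℕ) : Measure (Fin n → ℝ) :=
  Measure.pi fun _ => gaussianReal 0 1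

/-- The Lebesgue density of the standard Gaussian measure. -/
noncomputable def stdGaussianPDF {n : ℕ} (y : Fin n → ℝ) : ℝ :=
  ((Real.sqrt (2 * Real.pi))⁻¹) ^ n * Real.exp (-(y ⬝ᵥ y) / 2)

lemma stdGaussianPDF_pos {n : ℕ} (y : Fin n → ℝ) : 0 < stdGaussianPDF y := by
  unfold stdGaussianPDF; positivity

lemma stdGaussianPDF_eq_prod {n : ℕ} (y : Fin n → ℝ) :
    stdGaussianPDF y = ∏ i, gaussianPDFReal 0 1 (y i) := by
  simp only [gaussianPDFReal_def, stdGaussianPDF, Finset.prod_mul_distrib, Finset.prod_const,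
    Finset.card_univ, Fintype.card_fin, ← Real.exp_sum, dotProduct]
  simp [pow_two, Finset.sum_div, neg_div]

lemma continuous_stdGaussianPDF {n : ℕ} : Continuous (stdGaussianPDF (n := n)) := by
  unfold stdGaussianPDF dotProduct; fun_prop

lemma stdGaussianPi_eq_withDensity (n : ℕ) :
    stdGaussianPi n = volume.withDensity fun y => ENNReal.ofReal (stdGaussianPDF y) := by
  refine (Measure.pi_eq fun s hs => ?_)
  rw [withDensity_apply _ (MeasurableSet.univ_pi hs), ← lintegral_indicator (MeasurableSet.univ_pi hs)]
  have h1 : ∀ y : Fin n → ℝ, (Set.univ.pi s).indicator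
      (fun y => ENNReal.ofReal (stdGaussianPDF y)) y
      = ENNReal.ofReal (∏ i, (s i).indicator (gaussianPDFReal 0 1) (y i)) := by
    intro y
    by_cases hy : y ∈ Set.univ.pi s
    · rw [Set.indicator_of_mem hy, stdGaussianPDF_eq_prod]
      congr 1
      refine Finset.prod_congr rfl fun i _ => ?_
      rw [Set.indicator_of_mem (hy i (Set.mem_univ i))]
    · rw [Set.indicator_of_notMem hy]
      simp only [Set.mem_pi, Set.mem_univ, true_implies, not_forall] at hy
      obtain ⟨i, hi⟩ := hy
      rw [Finset.prod_eq_zero (Finset.mem_univ i) (Set.indicator_of_notMem hi _), ENNReal.ofReal_zero]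
  have hint : ∀ i, Integrable ((s i).indicator (gaussianPDFReal 0 1)) := fun i =>
    (integrable_gaussianPDFReal 0 1).indicator (hs i)
  have hnn : ∀ i x, 0 ≤ (s i).indicator (gaussianPDFReal 0 1) x := fun i x =>
    Set.indicator_nonneg (fun x _ => gaussianPDFReal_nonneg 0 1 x) x
  simp_rw [h1]
  rw [← ofReal_integral_eq_lintegral_ofReal (by exact Integrable.fintype_prod hint)
    (ae_of_all _ fun y => Finset.prod_nonneg fun i _ => hnn i _),
    integral_fintype_prod_volume_eq_prod, ENNReal.ofReal_prod_of_nonneg]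
  · refine Finset.prod_congr rfl fun i _ => ?_
    rw [integral_indicator (hs i), gaussianReal_apply_eq_integral 0 one_ne_zero]
  · exact fun i _ => integral_nonneg (hnn i)

lemma integrable_stdGaussianPi_iff {n : ℕ} {f : (Fin n → ℝ) → ℝ} :
    Integrable f (stdGaussianPi n) ↔ Integrable fun y => f y * stdGaussianPDF y := by
  rw [stdGaussianPi_eq_withDensity, integrable_withDensity_iff_integrable_smul₀'
    continuous_stdGaussianPDF.measurable.ennreal_ofReal.aemeasurable (by simp)]
  refine integrable_congr (ae_of_all _ fun y => ?_)
  simp [ENNReal.toReal_ofReal (stdGaussianPDF_pos y).le, mul_comm]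

lemma integral_stdGaussianPi {n : ℕ} (f : (Fin n → ℝ) → ℝ) :
    ∫ y, f y ∂stdGaussianPi n = ∫ y, f y * stdGaussianPDF y := by
  rw [stdGaussianPi_eq_withDensity, integral_withDensity_eq_integral_toReal_smul
    continuous_stdGaussianPDF.measurable.ennreal_ofReal (by simp)]
  refine integral_congr_ae (ae_of_all _ fun y => ?_)
  simp [ENNReal.toReal_ofReal (stdGaussianPDF_pos y).le, mul_comm]

/-- Translating a standard Gaussian vector by `h` tilts its law by
`exp (⟨y, h⟩ - |h|² / 2)`. -/
lemma lintegral_stdGaussianPi_add {n : ℕ} (h : Fin n → ℝ) {f : (Fin n → ℝ) → ℝ≥0∞}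
    (hf : Measurable f) :
    ∫⁻ w, f (h + w) ∂stdGaussianPi n
      = ∫⁻ y, ENNReal.ofReal (Real.exp (y ⬝ᵥ h - h ⬝ᵥ h / 2)) * f y ∂stdGaussianPi n := by
  have hφ : Measurable fun y : Fin n → ℝ => ENNReal.ofReal (stdGaussianPDF y) :=
    continuous_stdGaussianPDF.measurable.ennreal_ofReal
  have hexp : Measurable fun y : Fin n → ℝ =>
      ENNReal.ofReal (Real.exp (y ⬝ᵥ h - h ⬝ᵥ h / 2)) := by
    refine Measurable.ennreal_ofReal (Continuous.measurable ?_)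
    unfold dotProduct; fun_prop
  rw [stdGaussianPi_eq_withDensity, lintegral_withDensity_eq_lintegral_mul _ hφ (by fun_prop),
    lintegral_withDensity_eq_lintegral_mul _ hφ (by fun_prop),
    ← lintegral_add_left_eq_self _ (-h)]
  refine lintegral_congr fun y => ?_
  simp only [Pi.mul_apply, add_neg_cancel_left]
  rw [← mul_assoc, ← ENNReal.ofReal_mul (stdGaussianPDF_pos y).le]
  congr 2
  unfold stdGaussianPDF
  rw [mul_assoc, ← Real.exp_add]
  congr 2
  simp only [dotProduct_add, add_dotProduct, neg_dotProduct, dotProduct_neg, dotProduct_comm h y]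
  ring

lemma pi_norm_le_sum_abs {n : ℕ} (y : Fin n → ℝ) : ‖y‖ ≤ ∑ i, |y i| :=
  (pi_norm_le_iff_of_nonneg (Finset.sum_nonneg fun _ _ => abs_nonneg _)).2 fun i =>
    Finset.single_le_sum (f := fun i => |y i|) (fun _ _ => abs_nonneg _) (Finset.mem_univ i)

/-- The sup norm is at most the sum of the `|y i|`, and the exponential of that sum is a product of
one-dimensional integrable functions. This is the common dominating function for mixtures over a
cube. -/
lemma integrable_exp_mul_norm_stdGaussianPi (n : ℕ) (C : ℝ) :
    Integrable (fun y => Real.exp (C * ‖y‖)) (stdGaussianPi n) := by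
  have h1 : Integrable (fun x : ℝ => Real.exp (|C| * |x|)) (gaussianReal 0 1) :=
    integrable_exp_mul_abs (X := id) (integrable_exp_mul_gaussianReal _)
      (integrable_exp_mul_gaussianReal _)
  have h2 : Integrable (fun y : Fin n → ℝ => ∏ i, Real.exp (|C| * |y i|)) (stdGaussianPi n) :=
    Integrable.fintype_prod fun _ => h1
  refine h2.mono' (by fun_prop) (ae_of_all _ fun y => ?_)
  rw [Real.norm_eq_abs, Real.abs_exp, ← Real.exp_sum, ← Finset.mul_sum]
  refine Real.exp_le_exp.2 ?_
  calc C * ‖y‖ ≤ |C| * ‖y‖ := by gcongr; exact le_abs_self C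
    _ ≤ _ := by gcongr; exact pi_norm_le_sum_abs y

/-- Gaussian integration by parts in the direction `v`. -/
lemma integral_mul_dotProduct_stdGaussianPi {n : ℕ} {f f' : (Fin n → ℝ) → ℝ} {v : Fin n → ℝ}
    (hf : ∀ y, HasLineDerivAt ℝ f (f' y) y v)
    (h0 : Integrable f (stdGaussianPi n)) (h1 : Integrable f' (stdGaussianPi n))
    (h2 : Integrable (fun y => f y * (y ⬝ᵥ v)) (stdGaussianPi n)) :
    ∫ y, f y * (y ⬝ᵥ v) ∂stdGaussianPi n = ∫ y, f' y ∂stdGaussianPi n := by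
  have hφ : ∀ y : Fin n → ℝ, HasLineDerivAt ℝ stdGaussianPDF
      (-((y ⬝ᵥ v) * stdGaussianPDF y)) y v := by
    intro y
    have h : HasDerivAt (fun t : ℝ => -((y ⬝ᵥ y) + 2 * t * (y ⬝ᵥ v) + t ^ 2 * (v ⬝ᵥ v)) / 2)
        (-(y ⬝ᵥ v)) 0 := by
      have ht := hasDerivAt_id (0 : ℝ)
      convert! ((((ht.const_mul 2).mul_const (y ⬝ᵥ v)).const_add (y ⬝ᵥ y)).add
        ((ht.pow 2).mul_const (v ⬝ᵥ v))).neg.div_const 2 using 1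
      simp; ring
    have h' := (h.exp).const_mul (((Real.sqrt (2 * Real.pi))⁻¹) ^ n)
    unfold HasLineDerivAt
    convert! h' using 1
    · funext t
      simp only [stdGaussianPDF, add_dotProduct, dotProduct_add, smul_dotProduct, dotProduct_smul,
        smul_eq_mul, dotProduct_comm v y]
      congr 3; ring
    · simp [stdGaussianPDF]; ring
  -- Integration by parts for Lebesgue measure, with the density as second factor; integrability of
  -- the three products replaces boundary conditions.
  have key := integral_bilinear_hasLineDerivAt_right_eq_neg_left_of_integrable
    (μ := (volume : Measure (Fin n → ℝ))) (f := f) (f' := f') (g := stdGaussianPDF)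
    (g' := fun y => -((y ⬝ᵥ v) * stdGaussianPDF y)) (v := v)
    (B := ContinuousLinearMap.mul ℝ ℝ)
    (by simpa using integrable_stdGaussianPi_iff.1 h1)
    (by
      have := (integrable_stdGaussianPi_iff.1 h2).neg
      refine this.congr (ae_of_all _ fun y => ?_)
      simp; ring)
    (by simpa using integrable_stdGaussianPi_iff.1 h0)
    (fun y _ => hf y) (fun y _ => hφ y)
  simp only [ContinuousLinearMap.mul_apply'] at key
  rw [integral_stdGaussianPi, integral_stdGaussianPi]
  have e : ∀ y, f y * -((y ⬝ᵥ v) * stdGaussianPDF y) = -(f y * (y ⬝ᵥ v) * stdGaussianPDF y) :=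
    fun y => by ring
  simp_rw [e, integral_neg] at key
  linarith

open Filter Topology in
/-- Pratt's lemma: dominated convergence with a convergent dominating family. -/
lemma tendsto_integral_of_le_of_tendsto_integral {α ι : Type*} [MeasurableSpace α]
    {μ : Measure α} {l : Filter ι} [l.IsCountablyGenerated] {f g : ι → α → ℝ} {f₀ g₀ : α → ℝ}
    (hf : ∀ i, AEStronglyMeasurable (f i) μ)
    (hg : ∀ i, Integrable (g i) μ)
    (hg₀ : Integrable g₀ μ) (h0 : ∀ i x, 0 ≤ f i x) (hfg : ∀ i x, f i x ≤ g i x)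
    (hf₀0 : ∀ x, 0 ≤ f₀ x) (hfg₀ : ∀ x, f₀ x ≤ g₀ x)
    (hft : ∀ x, Tendsto (fun i => f i x) l (𝓝 (f₀ x)))
    (hgt : ∀ x, Tendsto (fun i => g i x) l (𝓝 (g₀ x)))
    (hint : Tendsto (fun i => ∫ x, g i x ∂μ) l (𝓝 (∫ x, g₀ x ∂μ))) :
    Tendsto (fun i => ∫ x, f i x ∂μ) l (𝓝 (∫ x, f₀ x ∂μ)) := by
  have hfi : ∀ i, Integrable (f i) μ := fun i => (hg i).mono' (hf i) (ae_of_all _ fun x => by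
    rw [Real.norm_of_nonneg (h0 i x)]; exact hfg i x)
  have hg₀0 : ∀ x, 0 ≤ g₀ x := fun x => (hf₀0 x).trans (hfg₀ x)
  -- Truncation at `g₀` makes ordinary dominated convergence applicable, both to `f` and to `g`.
  have lim : ∀ (p : ι → α → ℝ) (p₀ : α → ℝ), (∀ i, AEStronglyMeasurable (p i) μ) →
      (∀ i x, 0 ≤ p i x) → (∀ x, p₀ x ≤ g₀ x) →
      (∀ x, Tendsto (fun i => p i x) l (𝓝 (p₀ x))) →
      Tendsto (fun i => ∫ x, min (p i x) (g₀ x) ∂μ) l (𝓝 (∫ x, p₀ x ∂μ)) := by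
    intro p p₀ hp hp0 hp₀ hpt
    refine tendsto_integral_filter_of_dominated_convergence g₀
      (Eventually.of_forall fun i => (hp i).inf hg₀.aestronglyMeasurable)
      (Eventually.of_forall fun i => ae_of_all _ fun x => ?_) hg₀ (ae_of_all _ fun x => ?_)
    · rw [Real.norm_of_nonneg (le_min (hp0 i x) (hg₀0 x))]
      exact min_le_right _ _
    · have := (hpt x).min (tendsto_const_nhds (x := g₀ x))
      rwa [min_eq_left (hp₀ x)] at this
  have hL1 := lim f f₀ hf h0 hfg₀ hft
  have hL2 := lim g g₀ (fun i => (hg i).aestronglyMeasurable)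
    (fun i x => (h0 i x).trans (hfg i x)) (fun _ => le_rfl) hgt
  have mi : ∀ p : α → ℝ, Integrable p μ → Integrable (fun x => min (p x) (g₀ x)) μ :=
    fun p hp => hp.inf hg₀
  -- The part of `f i` above `g₀` is at most the part of `g i` above `g₀`, whose integral tends to
  -- `∫ g₀ - ∫ g₀ = 0`.
  have hsub : Tendsto (fun i => ∫ x, f i x ∂μ - ∫ x, min (f i x) (g₀ x) ∂μ) l (𝓝 0) := by
    have h3 := hint.sub hL2
    rw [sub_self] at h3
    refine squeeze_zero (fun i => ?_) (fun i => ?_) h3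
    · exact sub_nonneg.2 (integral_mono (mi _ (hfi i)) (hfi i) fun x => min_le_left _ _)
    · rw [← integral_sub (hfi i) (mi _ (hfi i)), ← integral_sub (hg i) (mi _ (hg i))]
      refine integral_mono ((hfi i).sub (mi _ (hfi i))) ((hg i).sub (mi _ (hg i))) fun x => ?_
      have := hfg i x
      simp only
      rcases le_total (f i x) (g₀ x) with h | h <;> rcases le_total (g i x) (g₀ x) with h' | h' <;>
        simp [h, h'] <;> linarith
  simpa using hsub.add hL1

/-! ### Mixtures of translated Gaussian measures -/

/-- The log-likelihood ratio of `A (a ∘ u) + w` and `w`, with `w` a standard Gaussian vector and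
`A` with orthonormal columns, at `y`. -/
noncomputable def logLik {n K : ℕ} (A : Matrix (Fin n) (Fin K) ℝ) (a u : Fin K → ℝ)
    (y : Fin n → ℝ) : ℝ :=
  ∑ k, (a k * u k * (Aᵀ *ᵥ y) k - (a k * u k) ^ 2 / 2)

/-- The likelihood ratio of `A (a ∘ u) + w` and `w`. -/
noncomputable def lik {n K : ℕ} (A : Matrix (Fin n) (Fin K) ℝ) (a u : Fin K → ℝ)
    (y : Fin n → ℝ) : ℝ :=
  Real.exp (logLik A a u y)

/-- The unnormalised posterior mean `∫ g(u) L(u, y) dμ(u)`. -/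
noncomputable def likInt {n K : ℕ} (A : Matrix (Fin n) (Fin K) ℝ) (μ : Measure (Fin K → ℝ))
    (g : (Fin K → ℝ) → ℝ) (a : Fin K → ℝ) (y : Fin n → ℝ) : ℝ :=
  ∫ u, g u * lik A a u y ∂μ

/-- The density of the mixture of the laws of `A (a ∘ u) + w` with respect to the law of `w`. -/
noncomputable abbrev evidence {n K : ℕ} (A : Matrix (Fin n) (Fin K) ℝ)
    (μ : Measure (Fin K → ℝ)) : (Fin K → ℝ) → (Fin n → ℝ) → ℝ :=
  likInt A μ fun _ => 1

/-- The unnormalised posterior mean of the `k`-th component. -/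
noncomputable abbrev firstMoment {n K : ℕ} (A : Matrix (Fin n) (Fin K) ℝ)
    (μ : Measure (Fin K → ℝ)) (k : Fin K) : (Fin K → ℝ) → (Fin n → ℝ) → ℝ :=
  likInt A μ fun u => u k

/-- The unnormalised posterior second moment of the `k`-th component. -/
noncomputable abbrev secondMoment {n K : ℕ} (A : Matrix (Fin n) (Fin K) ℝ)
    (μ : Measure (Fin K → ℝ)) (k : Fin K) : (Fin K → ℝ) → (Fin n → ℝ) → ℝ :=
  likInt A μ fun u => u k ^ 2

/-- The second moment of the posterior mean of the `k`-th component. -/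
noncomputable def estimateEnergy {n K : ℕ} (A : Matrix (Fin n) (Fin K) ℝ)
    (μ : Measure (Fin K → ℝ)) (k : Fin K) (a : Fin K → ℝ) : ℝ :=
  ∫ y, firstMoment A μ k a y ^ 2 / evidence A μ a y ∂stdGaussianPi n

/-- The relative entropy `∫ Z log Z dγ` of the mixture. -/
noncomputable def mixEntropy {n K : ℕ} (A : Matrix (Fin n) (Fin K) ℝ)
    (μ : Measure (Fin K → ℝ)) (a : Fin K → ℝ) : ℝ :=
  ∫ y, evidence A μ a y * Real.log (evidence A μ a y) ∂stdGaussianPi n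

section Lik

variable {n K : ℕ} (A : Matrix (Fin n) (Fin K) ℝ)

lemma lik_pos (a u : Fin K → ℝ) (y : Fin n → ℝ) : 0 < lik A a u y := Real.exp_pos _

lemma continuous_logLik :
    Continuous fun q : (Fin K → ℝ) × (Fin K → ℝ) × (Fin n → ℝ) => logLik A q.1 q.2.1 q.2.2 := by
  unfold logLik Matrix.mulVec dotProduct; fun_prop

lemma continuous_lik :
    Continuous fun q : (Fin K → ℝ) × (Fin K → ℝ) × (Fin n → ℝ) => lik A q.1 q.2.1 q.2.2 :=
  Real.continuous_exp.comp (continuous_logLik A)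

lemma measurable_lik (a : Fin K → ℝ) :
    Measurable fun q : (Fin K → ℝ) × (Fin n → ℝ) => lik A a q.1 q.2 :=
  ((continuous_lik A).comp (by fun_prop : Continuous fun q : (Fin K → ℝ) × (Fin n → ℝ) =>
    (a, q.1, q.2))).measurable

lemma measurable_lik_left (a : Fin K → ℝ) (y : Fin n → ℝ) : Measurable fun u => lik A a u y :=
  (measurable_lik A a).comp (measurable_id.prodMk measurable_const)

/-- Completing the square in each coordinate gives a bound free of `a` and `u`, so integrability in
`u` and continuity in `a` hold at every fixed `y` without a bound on the support. -/
lemma lik_le (a u : Fin K → ℝ) (y : Fin n → ℝ) :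
    lik A a u y ≤ Real.exp (∑ k, (Aᵀ *ᵥ y) k ^ 2 / 2) := by
  refine Real.exp_le_exp.2 (Finset.sum_le_sum fun k _ => ?_)
  nlinarith [sq_nonneg (a k * u k - (Aᵀ *ᵥ y) k)]

variable {A}

/-- Orthonormal columns give `|A v|² = |v|²`, which turns the coordinatewise expression into the
exponent of the Gaussian translation formula. -/
lemma logLik_eq (hA : Aᵀ * A = 1) (a u : Fin K → ℝ) (y : Fin n → ℝ) :
    logLik A a u y = y ⬝ᵥ (A *ᵥ (a * u)) - (A *ᵥ (a * u)) ⬝ᵥ (A *ᵥ (a * u)) / 2 := by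
  have h1 : ∀ z : Fin n → ℝ, z ⬝ᵥ (A *ᵥ (a * u)) = (Aᵀ *ᵥ z) ⬝ᵥ (a * u) := fun z => by
    rw [Matrix.dotProduct_mulVec, Matrix.mulVec_transpose]
  rw [h1, h1, Matrix.mulVec_mulVec, hA, Matrix.one_mulVec, logLik, Finset.sum_sub_distrib,
    ← Finset.sum_div]
  simp only [dotProduct, Pi.mul_apply]
  congr 1
  · exact Finset.sum_congr rfl fun k _ => by ring
  · congr 1; exact Finset.sum_congr rfl fun k _ => by ring

lemma lintegral_comp_add_stdGaussianPi (hA : Aᵀ * A = 1) (a u : Fin K → ℝ)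
    {f : (Fin n → ℝ) → ℝ≥0∞} (hf : Measurable f) :
    ∫⁻ w, f (A *ᵥ (a * u) + w) ∂stdGaussianPi n
      = ∫⁻ y, ENNReal.ofReal (lik A a u y) * f y ∂stdGaussianPi n := by
  rw [lintegral_stdGaussianPi_add _ hf]
  simp_rw [lik, logLik_eq hA]

lemma lintegral_lik (hA : Aᵀ * A = 1) (a u : Fin K → ℝ) :
    ∫⁻ y, ENNReal.ofReal (lik A a u y) ∂stdGaussianPi n = 1 := by
  have := lintegral_comp_add_stdGaussianPi hA a u (f := fun _ => 1) measurable_const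
  simpa using this.symm

lemma integrable_lik (hA : Aᵀ * A = 1) (a u : Fin K → ℝ) :
    Integrable (fun y => lik A a u y) (stdGaussianPi n) := by
  refine ⟨((measurable_lik A a).comp (measurable_const.prodMk measurable_id)).aestronglyMeasurable,
    ?_⟩
  rw [hasFiniteIntegral_iff_ofReal (ae_of_all _ fun y => (lik_pos A a u y).le), lintegral_lik hA]
  exact ENNReal.one_lt_top

lemma integral_lik (hA : Aᵀ * A = 1) (a u : Fin K → ℝ) :
    ∫ y, lik A a u y ∂stdGaussianPi n = 1 := by
  rw [integral_eq_lintegral_of_nonneg_ae (ae_of_all _ fun y => (lik_pos A a u y).le)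
    (integrable_lik hA a u).aestronglyMeasurable, lintegral_lik hA, ENNReal.toReal_one]

variable {μ : Measure (Fin K → ℝ)} {g : (Fin K → ℝ) → ℝ}

lemma integrable_mul_lik (hg : Integrable g μ) (a : Fin K → ℝ) (y : Fin n → ℝ) :
    Integrable (fun u => g u * lik A a u y) μ := by
  refine hg.mul_bdd (c := Real.exp (∑ k, (Aᵀ *ᵥ y) k ^ 2 / 2)) (measurable_lik_left A a y).aestronglyMeasurable
    (ae_of_all _ fun u => ?_)
  rw [Real.norm_of_nonneg (lik_pos A a u y).le]
  exact lik_le A a u y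

lemma likInt_nonneg (hg : ∀ u, 0 ≤ g u) (a : Fin K → ℝ) (y : Fin n → ℝ) :
    0 ≤ likInt A μ g a y :=
  integral_nonneg fun u => mul_nonneg (hg u) (lik_pos A a u y).le

lemma continuous_likInt (hg : Integrable g μ) (y : Fin n → ℝ) :
    Continuous fun a => likInt A μ g a y := by
  refine continuous_of_dominated
    (bound := fun u => ‖g u‖ * Real.exp (∑ k, (Aᵀ *ᵥ y) k ^ 2 / 2))
    (fun a => (integrable_mul_lik hg a y).aestronglyMeasurable)
    (fun a => ae_of_all _ fun u => ?_) (hg.norm.mul_const _) (ae_of_all _ fun u => ?_)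
  · rw [norm_mul, Real.norm_of_nonneg (lik_pos A a u y).le]
    gcongr
    exact lik_le A a u y
  · exact continuous_const.mul ((continuous_lik A).comp (by fun_prop :
      Continuous fun a : Fin K → ℝ => (a, u, y)))

lemma firstMoment_sq_div_nonneg (k : Fin K) (a : Fin K → ℝ) (y : Fin n → ℝ) :
    0 ≤ firstMoment A μ k a y ^ 2 / evidence A μ a y :=
  div_nonneg (sq_nonneg _) (likInt_nonneg (fun _ => zero_le_one) a y)

lemma integrable_prod_mul_lik (hA : Aᵀ * A = 1) (hg : Integrable g μ) (a : Fin K → ℝ) :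
    Integrable (fun q : (Fin K → ℝ) × (Fin n → ℝ) => g q.1 * lik A a q.1 q.2)
      (μ.prod (stdGaussianPi n)) := by
  have hm : AEStronglyMeasurable (fun q : (Fin K → ℝ) × (Fin n → ℝ) => g q.1 * lik A a q.1 q.2)
      (μ.prod (stdGaussianPi n)) :=
    hg.aestronglyMeasurable.comp_fst.mul (measurable_lik A a).aestronglyMeasurable
  rw [integrable_prod_iff hm]
  refine ⟨ae_of_all _ fun u => (integrable_lik hA a u).const_mul (g u), ?_⟩
  refine hg.norm.congr (ae_of_all _ fun u => ?_)
  simp only [norm_mul, Real.norm_of_nonneg (lik_pos A a u _).le]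
  rw [integral_const_mul, integral_lik hA, mul_one]

lemma estimateEnergy_nonneg (k : Fin K) (a : Fin K → ℝ) : 0 ≤ estimateEnergy A μ k a :=
  integral_nonneg fun y => firstMoment_sq_div_nonneg k a y

variable [IsFiniteMeasure μ]

lemma aestronglyMeasurable_likInt (hg : AEStronglyMeasurable g μ) (a : Fin K → ℝ) :
    AEStronglyMeasurable (likInt A μ g a) (stdGaussianPi n) := by
  have : AEStronglyMeasurable (fun q : (Fin n → ℝ) × (Fin K → ℝ) => g q.2 * lik A a q.2 q.1)
      ((stdGaussianPi n).prod μ) :=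
    hg.comp_snd.mul ((measurable_lik A a).comp measurable_swap).aestronglyMeasurable
  exact this.integral_prod_right'

lemma integrable_likInt (hA : Aᵀ * A = 1) (hg : Integrable g μ) (a : Fin K → ℝ) :
    Integrable (likInt A μ g a) (stdGaussianPi n) :=
  (integrable_prod_mul_lik hA hg a).integral_prod_right

/-- The likelihood has integral one in `y` for every `u` and `a`. The value does not depend on `a`,
which is what Pratt's lemma needs from the dominating family. -/
lemma integral_likInt (hA : Aᵀ * A = 1) (hg : Integrable g μ) (a : Fin K → ℝ) :
    ∫ y, likInt A μ g a y ∂stdGaussianPi n = ∫ u, g u ∂μ := by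
  unfold likInt
  rw [← integral_integral_swap (integrable_prod_mul_lik hA hg a)]
  refine integral_congr_ae (ae_of_all _ fun u => ?_)
  simp only
  rw [integral_const_mul, integral_lik hA, mul_one]

lemma evidence_pos [NeZero μ] (a : Fin K → ℝ) (y : Fin n → ℝ) : 0 < evidence A μ a y := by
  have hi := integrable_mul_lik (A := A) (integrable_const (μ := μ) (1 : ℝ)) a y
  unfold evidence likInt
  rw [integral_pos_iff_support_of_nonneg (fun u => by simpa using (lik_pos A a u y).le) hi]
  have : (Function.support fun u => (1 : ℝ) * lik A a u y) = Set.univ := by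
    ext u; simpa using (lik_pos A a u y).ne'
  rw [this]
  exact Measure.measure_univ_pos.2 (NeZero.ne μ)

lemma integrable_apply_of_sq {k : Fin K} (hk : Integrable (fun u => u k ^ 2) μ) :
    Integrable (fun u : Fin K → ℝ => u k) μ := by
  have : MemLp (fun u : Fin K → ℝ => u k) 2 μ :=
    (memLp_two_iff_integrable_sq (measurable_pi_apply k).aestronglyMeasurable).2 hk
  exact this.integrable (by norm_num)

/-- This is Cauchy-Schwarz, in the form that the unnormalised posterior variance `∫ (u_k - m)² L dμ`
at the posterior mean `m` is nonnegative. -/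
lemma firstMoment_sq_div_le {k : Fin K} (hk : Integrable (fun u => u k ^ 2) μ) (a : Fin K → ℝ)
    (y : Fin n → ℝ) :
    firstMoment A μ k a y ^ 2 / evidence A μ a y ≤ secondMoment A μ k a y := by
  have hQ : 0 ≤ secondMoment A μ k a y := likInt_nonneg (fun u => sq_nonneg _) a y
  have hZ : 0 ≤ evidence A μ a y := likInt_nonneg (fun u => zero_le_one) a y
  -- The evidence vanishes when `μ = 0`, and the quotient is then `0` by convention. The case is
  -- kept because restrictions to small cubes may be null.
  rcases hZ.eq_or_lt with hZ | hZ
  · rw [← hZ, div_zero]; exact hQ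
  set m := firstMoment A μ k a y / evidence A μ a y with hm
  have i0 := integrable_mul_lik (A := A) (integrable_const (μ := μ) (1 : ℝ)) a y
  have i1 := integrable_mul_lik (A := A) (integrable_apply_of_sq hk) a y
  have i2 := integrable_mul_lik (A := A) hk a y
  have key : 0 ≤ ∫ u, (u k - m) ^ 2 * lik A a u y ∂μ :=
    integral_nonneg fun u => mul_nonneg (sq_nonneg _) (lik_pos A a u y).le
  have e : ∀ u : Fin K → ℝ, (u k - m) ^ 2 * lik A a u y
      = u k ^ 2 * lik A a u y - 2 * m * (u k * lik A a u y) + m ^ 2 * (1 * lik A a u y) :=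
    fun u => by ring
  simp_rw [e] at key
  rw [integral_add (f := fun u => u k ^ 2 * lik A a u y - 2 * m * (u k * lik A a u y))
    (i2.sub (i1.const_mul _)) (i0.const_mul _), integral_sub i2 (i1.const_mul _),
    integral_const_mul, integral_const_mul] at key
  change 0 ≤ secondMoment A μ k a y - 2 * m * firstMoment A μ k a y + m ^ 2 * evidence A μ a y
    at key
  have h1 : firstMoment A μ k a y = m * evidence A μ a y := by rw [hm]; field_simp
  have h2 : firstMoment A μ k a y ^ 2 / evidence A μ a y = m ^ 2 * evidence A μ a y := by
    rw [h1]; field_simp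
  rw [h2]
  rw [h1] at key
  nlinarith

lemma aestronglyMeasurable_firstMoment_sq_div (k : Fin K) (a : Fin K → ℝ) :
    AEStronglyMeasurable (fun y => firstMoment A μ k a y ^ 2 / evidence A μ a y)
      (stdGaussianPi n) :=
  ((aestronglyMeasurable_likInt
    (measurable_pi_apply k).aestronglyMeasurable a).aemeasurable.pow_const 2 |>.div
    (aestronglyMeasurable_likInt aestronglyMeasurable_const a).aemeasurable).aestronglyMeasurable

lemma integrable_firstMoment_sq_div (hA : Aᵀ * A = 1) {k : Fin K}
    (hk : Integrable (fun u => u k ^ 2) μ) (a : Fin K → ℝ) :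
    Integrable (fun y => firstMoment A μ k a y ^ 2 / evidence A μ a y) (stdGaussianPi n) :=
  (integrable_likInt hA hk a).mono' (aestronglyMeasurable_firstMoment_sq_div k a)
    (ae_of_all _ fun y => by
      rw [Real.norm_of_nonneg (firstMoment_sq_div_nonneg k a y)]
      exact firstMoment_sq_div_le hk a y)

lemma estimateEnergy_le (hA : Aᵀ * A = 1) {k : Fin K} (hk : Integrable (fun u => u k ^ 2) μ)
    (a : Fin K → ℝ) : estimateEnergy A μ k a ≤ ∫ u, u k ^ 2 ∂μ := by
  rw [← integral_likInt hA hk a]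
  exact integral_mono (integrable_firstMoment_sq_div hA hk a) (integrable_likInt hA hk a)
    fun y => firstMoment_sq_div_le hk a y

/-- The dominating function `secondMoment A μ k b` varies with `b`, so plain dominated convergence
is not enough; but it converges pointwise and its integral is constant, so Pratt's lemma applies. -/
lemma continuous_estimateEnergy (hA : Aᵀ * A = 1) [NeZero μ] {k : Fin K}
    (hk : Integrable (fun u => u k ^ 2) μ) : Continuous (estimateEnergy A μ k) := by
  rw [continuous_iff_continuousAt]
  intro a
  refine tendsto_integral_of_le_of_tendsto_integral (g := secondMoment A μ k)
    (g₀ := secondMoment A μ k a)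
    (fun b => aestronglyMeasurable_firstMoment_sq_div k b)
    (fun b => integrable_likInt hA hk b) (integrable_likInt hA hk a)
    (fun b y => firstMoment_sq_div_nonneg k b y) (fun b y => firstMoment_sq_div_le hk b y)
    (fun y => firstMoment_sq_div_nonneg k a y) (fun y => firstMoment_sq_div_le hk a y)
    (fun y => ?_) (fun y => ?_) ?_
  · exact (((continuous_likInt (integrable_apply_of_sq hk) y).pow 2).div
      (continuous_likInt (integrable_const _) y) fun b => (evidence_pos b y).ne').tendsto a
  · exact (continuous_likInt hk y).tendsto a
  · simp_rw [integral_likInt hA hk]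
    exact tendsto_const_nhds

end Lik

/-! ### Families of exponentially bounded functions -/

/-- The functions `f i`, `i ∈ s`, are bounded by a common `exp (C (1 + ‖y‖))`. -/
def ExpBddOn {ι E : Type*} [Norm E] (s : Set ι) (f : ι → E → ℝ) : Prop :=
  ∃ C, 0 ≤ C ∧ ∀ i ∈ s, ∀ y, |f i y| ≤ Real.exp (C * (1 + ‖y‖))

namespace ExpBddOn

variable {ι E : Type*} [SeminormedAddCommGroup E] {s : Set ι} {f g : ι → E → ℝ}

lemma of_abs_le (hg : ExpBddOn s g) (h : ∀ i ∈ s, ∀ y, |f i y| ≤ |g i y|) : ExpBddOn s f := by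
  obtain ⟨C, hC, hg⟩ := hg
  exact ⟨C, hC, fun i hi y => (h i hi y).trans (hg i hi y)⟩

lemma of_linear (C : ℝ) (h : ∀ i ∈ s, ∀ y, |f i y| ≤ C * (1 + ‖y‖)) : ExpBddOn s f := by
  refine ⟨|C|, abs_nonneg C, fun i hi y => (h i hi y).trans ?_⟩
  have : C * (1 + ‖y‖) ≤ |C| * (1 + ‖y‖) := by gcongr; exact le_abs_self C
  linarith [Real.add_one_le_exp (|C| * (1 + ‖y‖))]

lemma of_bdd (C : ℝ) (h : ∀ i ∈ s, ∀ y, |f i y| ≤ C) : ExpBddOn s f := by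
  refine of_linear |C| fun i hi y => (h i hi y).trans ?_
  nlinarith [le_abs_self C, abs_nonneg C, norm_nonneg y]

lemma const (c : ℝ) : ExpBddOn s fun (_ : ι) (_ : E) => c := of_bdd |c| fun _ _ _ => le_rfl

lemma mul (hf : ExpBddOn s f) (hg : ExpBddOn s g) : ExpBddOn s fun i y => f i y * g i y := by
  obtain ⟨C, hC, hf⟩ := hf
  obtain ⟨D, hD, hg⟩ := hg
  refine ⟨C + D, add_nonneg hC hD, fun i hi y => ?_⟩
  rw [abs_mul, add_mul, Real.exp_add]
  exact mul_le_mul (hf i hi y) (hg i hi y) (abs_nonneg _) (Real.exp_pos _).le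

lemma add (hf : ExpBddOn s f) (hg : ExpBddOn s g) : ExpBddOn s fun i y => f i y + g i y := by
  obtain ⟨C, hC, hf⟩ := hf
  obtain ⟨D, hD, hg⟩ := hg
  -- The extra `1` in the constant absorbs the factor `2` from adding two exponentials, since `2 ≤
  -- exp (1 + ‖y‖)`.
  refine ⟨C + D + 1, by positivity, fun i hi y => (abs_add_le _ _).trans ?_⟩
  have hy := norm_nonneg y
  have h1 : Real.exp (C * (1 + ‖y‖)) ≤ Real.exp ((C + D) * (1 + ‖y‖)) :=
    Real.exp_le_exp.2 (by nlinarith)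
  have h2 : Real.exp (D * (1 + ‖y‖)) ≤ Real.exp ((C + D) * (1 + ‖y‖)) :=
    Real.exp_le_exp.2 (by nlinarith)
  have h3 : (2 : ℝ) ≤ Real.exp (1 + ‖y‖) := by linarith [Real.add_one_le_exp (1 + ‖y‖)]
  calc |f i y| + |g i y| ≤ 2 * Real.exp ((C + D) * (1 + ‖y‖)) := by
        linarith [hf i hi y, hg i hi y]
    _ ≤ Real.exp (1 + ‖y‖) * Real.exp ((C + D) * (1 + ‖y‖)) := by gcongr
    _ = _ := by rw [← Real.exp_add]; congr 1; ring

lemma sum {κ : Type*} {t : Finset κ} {F : κ → ι → E → ℝ} (h : ∀ k ∈ t, ExpBddOn s (F k)) :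
    ExpBddOn s fun i y => ∑ k ∈ t, F k i y := by
  classical
  induction t using Finset.induction_on with
  | empty => simpa using const (s := s) (E := E) 0
  | insert k t hk ih =>
    simp only [Finset.sum_insert hk]
    exact (h k (Finset.mem_insert_self k t)).add
      (ih fun j hj => h j (Finset.mem_insert_of_mem hj))

lemma integrable {n : ℕ} {f : ι → (Fin n → ℝ) → ℝ} (hf : ExpBddOn s f) {i : ι} (hi : i ∈ s)
    (hm : AEStronglyMeasurable (f i) (stdGaussianPi n)) : Integrable (f i) (stdGaussianPi n) := by
  obtain ⟨C, -, hf⟩ := hf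
  refine ((integrable_exp_mul_norm_stdGaussianPi n C).const_mul (Real.exp C)).mono' hm
    (ae_of_all _ fun y => (hf i hi y).trans_eq ?_)
  rw [← Real.exp_add]; congr 1; ring

end ExpBddOn

/-! ### Mixtures over a bounded set -/

section Bounded

variable {n K : ℕ} (A : Matrix (Fin n) (Fin K) ℝ)

lemma abs_mulVec_transpose_le (k : Fin K) (y : Fin n → ℝ) :
    |(Aᵀ *ᵥ y) k| ≤ (∑ i, |A i k|) * ‖y‖ := by
  rw [Finset.sum_mul]
  change |∑ i, A i k * y i| ≤ _
  refine (Finset.abs_sum_le_sum_abs _ _).trans (Finset.sum_le_sum fun i _ => ?_)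
  rw [abs_mul]
  exact mul_le_mul_of_nonneg_left (norm_le_pi_norm y i) (abs_nonneg _)

/-- With `a` and `u` bounded the log-likelihood grows linearly in `y`. Hence the evidence, its
inverse and its logarithm are all exponentially bounded, uniformly in `a`. -/
lemma exists_abs_logLik_le (B R : ℝ) (hB : 0 ≤ B) (hR : 0 ≤ R) :
    ∃ C, 0 ≤ C ∧ ∀ a u : Fin K → ℝ, ∀ y, (∀ k, |a k| ≤ B) → (∀ k, |u k| ≤ R) →
      |logLik A a u y| ≤ C * (1 + ‖y‖) := by
  refine ⟨∑ k, (B * R * (∑ i, |A i k|) + (B * R) ^ 2 / 2), by positivity,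
    fun a u y ha hu => ?_⟩
  rw [Finset.sum_mul]
  refine (Finset.abs_sum_le_sum_abs _ _).trans (Finset.sum_le_sum fun k _ => ?_)
  have h1 : |a k * u k| ≤ B * R := by
    rw [abs_mul]; exact mul_le_mul (ha k) (hu k) (abs_nonneg _) hB
  have h2 : (a k * u k) ^ 2 ≤ (B * R) ^ 2 := sq_le_sq' (by linarith [neg_abs_le (a k * u k)])
    ((le_abs_self _).trans h1)
  have h3 : |a k * u k * (Aᵀ *ᵥ y) k| ≤ B * R * ((∑ i, |A i k|) * ‖y‖) := by
    rw [abs_mul]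
    exact mul_le_mul h1 (abs_mulVec_transpose_le A k y) (abs_nonneg _) (by positivity)
  have hS : 0 ≤ ∑ i, |A i k| := by positivity
  have hBR : 0 ≤ B * R := by positivity
  calc _ ≤ |a k * u k * (Aᵀ *ᵥ y) k| + |(a k * u k) ^ 2 / 2| := abs_sub _ _
    _ ≤ B * R * ((∑ i, |A i k|) * ‖y‖) + (B * R) ^ 2 / 2 := by
      rw [abs_of_nonneg (by positivity : 0 ≤ (a k * u k) ^ 2 / 2)]; gcongr
    _ ≤ _ := by nlinarith [mul_nonneg hBR hS, norm_nonneg y, mul_nonneg (sq_nonneg (B * R)) (norm_nonneg y)]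

variable {A} {μ : Measure (Fin K → ℝ)} [IsFiniteMeasure μ] {g : (Fin K → ℝ) → ℝ} {R B : ℝ}

lemma integrable_of_box (hR : ∀ᵐ u ∂μ, ∀ k, |u k| ≤ R) (hg : Continuous g) : Integrable g μ := by
  have hc : IsCompact (Set.univ.pi fun _ : Fin K => Set.Icc (-R) R) :=
    isCompact_univ_pi fun _ => isCompact_Icc
  obtain ⟨G, hG⟩ := hc.exists_bound_of_continuousOn hg.continuousOn
  refine Integrable.of_bound hg.aestronglyMeasurable G ?_
  filter_upwards [hR] with u hu
  exact hG u fun k _ => abs_le.1 (hu k)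

/-- The integrals `∫ g L dμ` are differentiable along affine paths. -/
lemma hasDerivAt_likInt (hR : ∀ᵐ u ∂μ, ∀ k, |u k| ≤ R) (hg : Continuous g) (a d : Fin K → ℝ)
    (y e : Fin n → ℝ) :
    HasDerivAt (fun t : ℝ => likInt A μ g (a + t • d) (y + t • e))
      (∫ u, g u * (∑ k, (d k * u k * (Aᵀ *ᵥ y) k + a k * u k * (Aᵀ *ᵥ e) k
        - a k * d k * u k ^ 2)) * lik A a u y ∂μ) 0 := by
  let F' : ℝ → (Fin K → ℝ) → ℝ := fun t u => g u *
    (∑ k, (d k * u k * (Aᵀ *ᵥ (y + t • e)) k + (a + t • d) k * u k * (Aᵀ *ᵥ e) k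
        - (a + t • d) k * d k * u k ^ 2)) * lik A (a + t • d) u (y + t • e)
  have hlik : Continuous fun q : ℝ × (Fin K → ℝ) => lik A (a + q.1 • d) q.2 (y + q.1 • e) :=
    (continuous_lik A).comp (by fun_prop : Continuous fun q : ℝ × (Fin K → ℝ) =>
      (a + q.1 • d, q.2, y + q.1 • e))
  have hF' : Continuous fun q : ℝ × (Fin K → ℝ) => F' q.1 q.2 := by
    simp only [F', Matrix.mulVec, dotProduct, Pi.add_apply, Pi.smul_apply]
    fun_prop
  -- For `t` in `[-1, 1]` and `u` in the cube, the continuous derivative `F'` is bounded by a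
  -- constant, which serves as the dominating function.
  have hc : IsCompact (Set.Icc (-1 : ℝ) 1 ×ˢ Set.univ.pi fun _ : Fin K => Set.Icc (-R) R) :=
    isCompact_Icc.prod (isCompact_univ_pi fun _ => isCompact_Icc)
  obtain ⟨C, hC⟩ := hc.exists_bound_of_continuousOn hF'.continuousOn
  have hderiv : ∀ u t, HasDerivAt
      (fun t : ℝ => g u * lik A (a + t • d) u (y + t • e)) (F' t u) t := by
    intro u t
    have hk : ∀ k, HasDerivAt (fun t : ℝ => (a + t • d) k * u k * (Aᵀ *ᵥ (y + t • e)) k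
        - ((a + t • d) k * u k) ^ 2 / 2)
        (d k * u k * (Aᵀ *ᵥ (y + t • e)) k + (a + t • d) k * u k * (Aᵀ *ᵥ e) k
        - (a + t • d) k * d k * u k ^ 2) t := by
      intro k
      have h1 : HasDerivAt (fun t : ℝ => (a + t • d) k * u k) (d k * u k) t := by
        simpa using (((hasDerivAt_id t).mul_const (d k)).const_add (a k)).mul_const (u k)
      have h2 : HasDerivAt (fun t : ℝ => (Aᵀ *ᵥ (y + t • e)) k) ((Aᵀ *ᵥ e) k) t := by
        simp only [Matrix.mulVec_add, Matrix.mulVec_smul, Pi.add_apply, Pi.smul_apply, smul_eq_mul]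
        simpa using ((hasDerivAt_id t).mul_const ((Aᵀ *ᵥ e) k)).const_add ((Aᵀ *ᵥ y) k)
      convert! (h1.mul h2).sub ((h1.pow 2).div_const 2) using 1
      simp only [Nat.cast_ofNat, Nat.add_one_sub_one, pow_one]
      ring
    have hsum := HasDerivAt.fun_sum fun (k : Fin K) (_ : k ∈ Finset.univ) => hk k
    convert! (hsum.exp).const_mul (g u) using 1
    simp only [F', lik, logLik]
    ring
  have key := (hasDerivAt_integral_of_dominated_loc_of_deriv_le (μ := μ) (x₀ := (0 : ℝ))
    (F := fun t u => g u * lik A (a + t • d) u (y + t • e)) (F' := F')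
    (bound := fun _ => C) (Metric.ball_mem_nhds (0 : ℝ) one_pos)
    (Filter.Eventually.of_forall fun t =>
      (integrable_mul_lik (integrable_of_box hR hg) _ _).aestronglyMeasurable)
    (integrable_mul_lik (integrable_of_box hR hg) _ _)
    (hF'.comp (by fun_prop : Continuous fun u : Fin K → ℝ => ((0 : ℝ), u))).aestronglyMeasurable
    (by
      filter_upwards [hR] with u hu t ht
      refine hC (t, u) ⟨?_, fun k _ => abs_le.1 (hu k)⟩
      rw [Metric.mem_ball, dist_zero_right, Real.norm_eq_abs, abs_lt] at ht
      exact ⟨ht.1.le, ht.2.le⟩)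
    (integrable_const C)
    (ae_of_all _ fun u t _ => hderiv u t)).2
  simp only [F', zero_smul, add_zero] at key
  exact key

/-- The derivative of `∫ g L dμ` with respect to the amplitudes. -/
lemma hasDerivAt_likInt_left (hR : ∀ᵐ u ∂μ, ∀ k, |u k| ≤ R) (a d : Fin K → ℝ)
    (y : Fin n → ℝ) :
    HasDerivAt (fun t : ℝ => evidence A μ (a + t • d) y)
      (∑ k, d k * ((Aᵀ *ᵥ y) k * firstMoment A μ k a y - a k * secondMoment A μ k a y)) 0 := by
  have h := hasDerivAt_likInt (A := A) hR (g := fun _ => 1) continuous_const a d y 0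
  simp only [smul_zero, add_zero] at h
  convert! h using 1
  have i1 : ∀ k, Integrable (fun u => u k * lik A a u y) μ := fun k =>
    integrable_mul_lik (integrable_of_box hR (continuous_apply k)) a y
  have i2 : ∀ k, Integrable (fun u => u k ^ 2 * lik A a u y) μ := fun k =>
    integrable_mul_lik (integrable_of_box hR ((continuous_apply k).pow 2)) a y
  simp only [Matrix.mulVec_zero, Pi.zero_apply, mul_zero, add_zero, one_mul, Finset.sum_mul]
  rw [integral_finsetSum]
  · refine Finset.sum_congr rfl fun k _ => ?_
    have : ∀ u : Fin K → ℝ, (d k * u k * (Aᵀ *ᵥ y) k - a k * d k * u k ^ 2) * lik A a u y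
        = d k * (Aᵀ *ᵥ y) k * (u k * lik A a u y) - d k * a k * (u k ^ 2 * lik A a u y) :=
      fun u => by ring
    simp_rw [this]
    rw [integral_sub ((i1 k).const_mul _) ((i2 k).const_mul _), integral_const_mul,
      integral_const_mul]
    simp only [firstMoment, secondMoment, likInt]
    ring
  · intro k _
    have : ∀ u : Fin K → ℝ, (d k * u k * (Aᵀ *ᵥ y) k - a k * d k * u k ^ 2) * lik A a u y
        = d k * (Aᵀ *ᵥ y) k * (u k * lik A a u y) - d k * a k * (u k ^ 2 * lik A a u y) :=
      fun u => by ring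
    simp_rw [this]
    exact ((i1 k).const_mul _).sub ((i2 k).const_mul _)

/-- The derivative of `∫ g L dμ` with respect to the observation. -/
lemma hasLineDerivAt_likInt (hA : Aᵀ * A = 1) (hR : ∀ᵐ u ∂μ, ∀ k, |u k| ≤ R) (hg : Continuous g)
    (a : Fin K → ℝ) (k : Fin K) (y : Fin n → ℝ) :
    HasLineDerivAt ℝ (likInt A μ g a) (a k * likInt A μ (fun u => g u * u k) a y) y
      (fun i => A i k) := by
  have h := hasDerivAt_likInt (A := A) hR hg a 0 y (fun i => A i k)
  simp only [smul_zero, add_zero] at h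
  unfold HasLineDerivAt
  convert! h using 1
  -- Moving `y` along the `k`-th column changes only the `k`-th coordinate of `Aᵀ y`, so a single
  -- term of the sum survives.
  have hd : ∀ j, (Aᵀ *ᵥ fun i => A i k) j = if j = k then 1 else 0 := fun j => by
    have : (Aᵀ *ᵥ fun i => A i k) j = (Aᵀ * A) j k := rfl
    rw [this, hA, Matrix.one_apply]
  simp only [hd]
  unfold likInt
  rw [← integral_const_mul]
  refine integral_congr_ae (ae_of_all _ fun u => ?_)
  simp
  ring

lemma expBddOn_likInt (hR : ∀ᵐ u ∂μ, ∀ k, |u k| ≤ R) (hR0 : 0 ≤ R) (hB : 0 ≤ B)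
    (hg : Continuous g) :
    ExpBddOn {a : Fin K → ℝ | ∀ k, |a k| ≤ B} (likInt A μ g) := by
  obtain ⟨C, hC0, hC⟩ := exists_abs_logLik_le A B R hB hR0
  have h1 : ExpBddOn {a : Fin K → ℝ | ∀ k, |a k| ≤ B} fun (_ : Fin K → ℝ) (y : Fin n → ℝ) =>
      Real.exp (C * (1 + ‖y‖)) := ⟨C, hC0, fun _ _ y => by rw [Real.abs_exp]⟩
  refine ((ExpBddOn.const (∫ u, |g u| ∂μ)).mul h1).of_abs_le fun a ha y => ?_
  rw [abs_of_nonneg (mul_nonneg (integral_nonneg fun _ => abs_nonneg _) (Real.exp_pos _).le),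
    ← integral_mul_const]
  refine norm_integral_le_of_norm_le (f := fun u => g u * lik A a u y)
    ((integrable_of_box hR hg).abs.mul_const _) ?_
  filter_upwards [hR] with u hu
  rw [norm_mul, Real.norm_eq_abs, Real.norm_of_nonneg (lik_pos A a u y).le]
  gcongr
  exact Real.exp_le_exp.2 ((le_abs_self _).trans (hC a u y ha hu))

/-- The lower bound is the one that matters: it controls `Z⁻¹` and the negative part of `log Z`. -/
lemma exists_le_evidence (hR : ∀ᵐ u ∂μ, ∀ k, |u k| ≤ R) (hR0 : 0 ≤ R) (hB : 0 ≤ B) :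
    ∃ C, 0 ≤ C ∧ ∀ a : Fin K → ℝ, (∀ k, |a k| ≤ B) → ∀ y,
      μ.real Set.univ * Real.exp (-(C * (1 + ‖y‖))) ≤ evidence A μ a y ∧
      evidence A μ a y ≤ μ.real Set.univ * Real.exp (C * (1 + ‖y‖)) := by
  obtain ⟨C, hC0, hC⟩ := exists_abs_logLik_le A B R hB hR0
  refine ⟨C, hC0, fun a ha y => ?_⟩
  have hi := integrable_mul_lik (A := A) (integrable_const (μ := μ) (1 : ℝ)) a y
  have hc : ∀ c : ℝ, μ.real Set.univ * c = ∫ _, c ∂μ := fun c => by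
    rw [integral_const, smul_eq_mul]
  rw [hc, hc]
  constructor
  · refine integral_mono_ae (integrable_const _) hi ?_
    filter_upwards [hR] with u hu
    rw [one_mul]
    exact Real.exp_le_exp.2 (neg_le_of_abs_le (hC a u y ha hu))
  · refine integral_mono_ae hi (integrable_const _) ?_
    filter_upwards [hR] with u hu
    rw [one_mul]
    exact Real.exp_le_exp.2 ((le_abs_self _).trans (hC a u y ha hu))

lemma expBddOn_inv_evidence [NeZero μ] (hR : ∀ᵐ u ∂μ, ∀ k, |u k| ≤ R) (hR0 : 0 ≤ R) (hB : 0 ≤ B) :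
    ExpBddOn {a : Fin K → ℝ | ∀ k, |a k| ≤ B} fun a y => (evidence A μ a y)⁻¹ := by
  obtain ⟨C, hC0, hC⟩ := exists_le_evidence (A := A) hR hR0 hB
  have h1 : ExpBddOn {a : Fin K → ℝ | ∀ k, |a k| ≤ B} fun (_ : Fin K → ℝ) (y : Fin n → ℝ) =>
      Real.exp (C * (1 + ‖y‖)) := ⟨C, hC0, fun _ _ y => by rw [Real.abs_exp]⟩
  have hm : 0 < μ.real Set.univ := by simp [Measure.real, ENNReal.toReal_pos_iff, NeZero.ne μ, pos_iff_ne_zero]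
  refine ((ExpBddOn.const (μ.real Set.univ)⁻¹).mul h1).of_abs_le fun a ha y => ?_
  rw [abs_of_pos (inv_pos.2 (evidence_pos a y)), abs_of_pos (by positivity)]
  refine (inv_anti₀ (by positivity) (hC a ha y).1).trans_eq ?_
  rw [mul_inv, Real.exp_neg, inv_inv]

lemma expBddOn_log_evidence [NeZero μ] (hR : ∀ᵐ u ∂μ, ∀ k, |u k| ≤ R) (hR0 : 0 ≤ R) (hB : 0 ≤ B) :
    ExpBddOn {a : Fin K → ℝ | ∀ k, |a k| ≤ B} fun a y => Real.log (evidence A μ a y) := by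
  obtain ⟨C, hC0, hC⟩ := exists_le_evidence (A := A) hR hR0 hB
  have hm : 0 < μ.real Set.univ := by simp [Measure.real, ENNReal.toReal_pos_iff, NeZero.ne μ, pos_iff_ne_zero]
  refine ExpBddOn.of_linear (|Real.log (μ.real Set.univ)| + C) fun a ha y => ?_
  have h1 := Real.log_le_log (by positivity) (hC a ha y).1
  have h2 := Real.log_le_log (evidence_pos a y) (hC a ha y).2
  rw [Real.log_mul hm.ne' (Real.exp_pos _).ne', Real.log_exp] at h1 h2
  have h3 : |Real.log (μ.real Set.univ)| ≤ |Real.log (μ.real Set.univ)| * (1 + ‖y‖) := by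
    nlinarith [abs_nonneg (Real.log (μ.real Set.univ)), norm_nonneg y]
  rw [abs_le, add_mul]
  constructor
  · linarith [neg_abs_le (Real.log (μ.real Set.univ))]
  · linarith [le_abs_self (Real.log (μ.real Set.univ))]

lemma expBddOn_mulVec (s : Set (Fin K → ℝ)) (k : Fin K) :
    ExpBddOn s fun _ y => (Aᵀ *ᵥ y) k := by
  refine ExpBddOn.of_linear (∑ i, |A i k|) fun a _ y => (abs_mulVec_transpose_le A k y).trans ?_
  gcongr
  linarith

lemma aestronglyMeasurable_mulVec (k : Fin K) :
    AEStronglyMeasurable (fun y : Fin n → ℝ => (Aᵀ *ᵥ y) k) (stdGaussianPi n) := by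
  refine Continuous.aestronglyMeasurable ?_
  unfold Matrix.mulVec dotProduct; fun_prop

lemma aestronglyMeasurable_log_evidence (a : Fin K → ℝ) :
    AEStronglyMeasurable (fun y => Real.log (evidence A μ a y)) (stdGaussianPi n) :=
  (Real.measurable_log.comp_aemeasurable
    (aestronglyMeasurable_likInt aestronglyMeasurable_const a).aemeasurable).aestronglyMeasurable

/-- Write `N`, `Q` for the first and second moments and integrate `(log Z + 1) N` by parts along the
`k`-th column of `A`. In that direction `log Z` has derivative `a_k N / Z` and `N` has derivative
`a_k Q`. The resulting term `a_k (log Z + 1) Q` cancels the one that is subtracted, and `a_k ∫ N² /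
Z dγ` remains. -/
lemma integral_log_evidence_mul_firstMoment [NeZero μ] (hA : Aᵀ * A = 1)
    (hR : ∀ᵐ u ∂μ, ∀ k, |u k| ≤ R) (hR0 : 0 ≤ R) (a : Fin K → ℝ) (k : Fin K) :
    ∫ y, (Real.log (evidence A μ a y) + 1) *
        ((Aᵀ *ᵥ y) k * firstMoment A μ k a y - a k * secondMoment A μ k a y) ∂stdGaussianPi n
      = a k * estimateEnergy A μ k a := by
  have ha : a ∈ {b : Fin K → ℝ | ∀ k, |b k| ≤ ‖a‖} := fun k => norm_le_pi_norm a k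
  have hB := norm_nonneg a
  have b1 := (expBddOn_log_evidence (A := A) hR hR0 hB).add (ExpBddOn.const 1)
  have bN := expBddOn_likInt (A := A) hR hR0 hB (continuous_apply k)
  have bQ := expBddOn_likInt (A := A) hR hR0 hB ((continuous_apply k).pow 2)
  have bI := expBddOn_inv_evidence (A := A) hR hR0 hB
  have bx := expBddOn_mulVec (A := A) {b : Fin K → ℝ | ∀ k, |b k| ≤ ‖a‖} k
  have m1 : AEStronglyMeasurable (fun y => Real.log (evidence A μ a y) + 1) (stdGaussianPi n) :=
    (aestronglyMeasurable_log_evidence a).add aestronglyMeasurable_const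
  have mN : AEStronglyMeasurable (firstMoment A μ k a) (stdGaussianPi n) :=
    aestronglyMeasurable_likInt (measurable_pi_apply k).aestronglyMeasurable a
  have mQ : AEStronglyMeasurable (secondMoment A μ k a) (stdGaussianPi n) :=
    aestronglyMeasurable_likInt ((measurable_pi_apply k).pow_const 2).aestronglyMeasurable a
  have hk := integrable_of_box (g := fun u : Fin K → ℝ => u k ^ 2) hR ((continuous_apply k).pow 2)
  have mx := aestronglyMeasurable_mulVec (A := A) k
  have i0 : Integrable (fun y => (Real.log (evidence A μ a y) + 1) * firstMoment A μ k a y)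
      (stdGaussianPi n) := (b1.mul bN).integrable ha (m1.mul mN)
  have i0x : Integrable (fun y => (Real.log (evidence A μ a y) + 1) * firstMoment A μ k a y
      * (Aᵀ *ᵥ y) k) (stdGaussianPi n) :=
    ((b1.mul bN).mul bx).integrable ha ((m1.mul mN).mul mx)
  have iQ : Integrable (fun y => (Real.log (evidence A μ a y) + 1) * secondMoment A μ k a y)
      (stdGaussianPi n) := (b1.mul bQ).integrable ha (m1.mul mQ)
  have iE := integrable_firstMoment_sq_div hA hk a
  have hline : ∀ y, HasLineDerivAt ℝ
      (fun y => (Real.log (evidence A μ a y) + 1) * firstMoment A μ k a y)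
      (a k * (firstMoment A μ k a y ^ 2 / evidence A μ a y)
        + a k * ((Real.log (evidence A μ a y) + 1) * secondMoment A μ k a y)) y
      (fun i => A i k) := by
    intro y
    have hZ := hasLineDerivAt_likInt (A := A) hA hR (g := fun _ => 1) continuous_const a k y
    have hN := hasLineDerivAt_likInt (A := A) hA hR (continuous_apply k) a k y
    have hpos : evidence A μ a (y + (0 : ℝ) • fun i => A i k) ≠ 0 := (evidence_pos a _).ne'
    unfold HasLineDerivAt at hZ hN ⊢
    convert! ((hZ.log hpos).add_const 1).mul hN using 1
    simp only [zero_smul, add_zero, one_mul, ← pow_two]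
    ring
  have key := integral_mul_dotProduct_stdGaussianPi hline i0 ((iE.const_mul _).add (iQ.const_mul _))
    (by
      refine i0x.congr (ae_of_all _ fun y => ?_)
      simp only [Matrix.mulVec, dotProduct_comm]; rfl)
  rw [integral_add (iE.const_mul _) (iQ.const_mul _), integral_const_mul, integral_const_mul] at key
  have e : ∀ y, (Real.log (evidence A μ a y) + 1) *
        ((Aᵀ *ᵥ y) k * firstMoment A μ k a y - a k * secondMoment A μ k a y)
      = (Real.log (evidence A μ a y) + 1) * firstMoment A μ k a y * (Aᵀ *ᵥ y) k
        - a k * ((Real.log (evidence A μ a y) + 1) * secondMoment A μ k a y) := fun y => by ring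
  simp_rw [e]
  rw [integral_sub i0x (iQ.const_mul _), integral_const_mul]
  have e2 : ∀ y : Fin n → ℝ, (Aᵀ *ᵥ y) k = y ⬝ᵥ fun i => A i k := fun y => by
    simp only [Matrix.mulVec, dotProduct_comm]; rfl
  simp_rw [e2, key, estimateEnergy]
  ring

/-- Differentiation under the integral, with `(z log z)' = log z + 1`; each component of the result
is then evaluated by the integration by parts above. -/
lemma hasDerivAt_mixEntropy_zero [NeZero μ] (hA : Aᵀ * A = 1)
    (hR : ∀ᵐ u ∂μ, ∀ k, |u k| ≤ R) (hR0 : 0 ≤ R) (a d : Fin K → ℝ) :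
    HasDerivAt (fun t : ℝ => mixEntropy A μ (a + t • d))
      (∑ k, d k * (a k * estimateEnergy A μ k a)) 0 := by
  set s : Set (Fin K → ℝ) := {b : Fin K → ℝ | ∀ k, |b k| ≤ ‖a‖ + ‖d‖} with hs
  have hB : 0 ≤ ‖a‖ + ‖d‖ := by positivity
  have hmem : ∀ t ∈ Metric.ball (0 : ℝ) 1, a + t • d ∈ s := by
    intro t ht k
    rw [Metric.mem_ball, dist_zero_right, Real.norm_eq_abs] at ht
    have h1 : |a k| ≤ ‖a‖ := norm_le_pi_norm a k
    have h2 : |d k| ≤ ‖d‖ := norm_le_pi_norm d k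
    calc |a k + t * d k| ≤ |a k| + |t| * |d k| := by rw [← abs_mul]; exact abs_add_le _ _
      _ ≤ ‖a‖ + 1 * ‖d‖ := by gcongr
      _ = _ := by ring
  have ha : a ∈ s := by simpa using hmem 0 (Metric.mem_ball_self one_pos)
  -- The difference is written as a sum with a factor `-1`, because the closure rules of `ExpBddOn`
  -- are for sums and products.
  let D : Fin K → (Fin K → ℝ) → (Fin n → ℝ) → ℝ := fun k b y =>
    d k * ((Aᵀ *ᵥ y) k * firstMoment A μ k b y + (-1) * b k * secondMoment A μ k b y)
  let H : (Fin K → ℝ) → (Fin n → ℝ) → ℝ := fun b y =>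
    (Real.log (evidence A μ b y) + 1) * ∑ k, D k b y
  have b1 := (expBddOn_log_evidence (A := A) hR hR0 hB).add (ExpBddOn.const 1)
  have bN := fun k => expBddOn_likInt (A := A) hR hR0 hB (continuous_apply k)
  have bQ := fun k => expBddOn_likInt (A := A) hR hR0 hB ((continuous_apply k).pow 2)
  have bx := fun k => expBddOn_mulVec (A := A) s k
  have bc : ∀ k : Fin K, ExpBddOn s fun b (_ : Fin n → ℝ) => b k := fun k =>
    ExpBddOn.of_bdd (‖a‖ + ‖d‖) fun b hb _ => hb k
  have bD : ∀ k, ExpBddOn s (D k) := fun k =>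
    (ExpBddOn.const _).mul (((bx k).mul (bN k)).add (((ExpBddOn.const _).mul (bc k)).mul (bQ k)))
  have bH : ExpBddOn s H := b1.mul (ExpBddOn.sum fun k _ => bD k)
  have mN : ∀ k b, AEStronglyMeasurable (firstMoment A μ k b) (stdGaussianPi n) := fun k b =>
    aestronglyMeasurable_likInt (measurable_pi_apply k).aestronglyMeasurable b
  have mQ : ∀ k b, AEStronglyMeasurable (secondMoment A μ k b) (stdGaussianPi n) := fun k b =>
    aestronglyMeasurable_likInt ((measurable_pi_apply k).pow_const 2).aestronglyMeasurable b
  have mZ : ∀ b, AEStronglyMeasurable (evidence A μ b) (stdGaussianPi n) := fun b =>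
    aestronglyMeasurable_likInt aestronglyMeasurable_const b
  have m1 : ∀ b, AEStronglyMeasurable (fun y => Real.log (evidence A μ b y) + 1)
      (stdGaussianPi n) := fun b =>
    (aestronglyMeasurable_log_evidence b).add aestronglyMeasurable_const
  have mD : ∀ k b, AEStronglyMeasurable (D k b) (stdGaussianPi n) := fun k b =>
    (((aestronglyMeasurable_mulVec k).mul (mN k b)).add ((mQ k b).const_mul _)).const_mul _
  have mlD : ∀ k b, AEStronglyMeasurable (fun y => (Real.log (evidence A μ b y) + 1) * D k b y)
      (stdGaussianPi n) := fun k b => (m1 b).mul (mD k b)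
  have ilD : ∀ k, Integrable (fun y => (Real.log (evidence A μ a y) + 1) * D k a y)
      (stdGaussianPi n) := fun k => (b1.mul (bD k)).integrable ha (mlD k a)
  have mH : AEStronglyMeasurable (H a) (stdGaussianPi n) := by
    simp only [H, Finset.mul_sum]
    exact (integrable_finsetSum _ fun k _ => ilD k).aestronglyMeasurable
  have hderiv : ∀ y t, HasDerivAt (fun t : ℝ => evidence A μ (a + t • d) y *
      Real.log (evidence A μ (a + t • d) y)) (H (a + t • d) y) t := by
    intro y t
    have h0 := hasDerivAt_likInt_left (A := A) hR (a + t • d) d y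
    have h1 : HasDerivAt (fun s : ℝ => evidence A μ (a + s • d) y) (∑ k, D k (a + t • d) y) t := by
      have h0' : HasDerivAt (fun s : ℝ => evidence A μ (a + t • d + s • d) y)
          (∑ k, D k (a + t • d) y) (t - t) := by
        rw [sub_self]
        convert! h0 using 1
        refine Finset.sum_congr rfl fun k _ => ?_
        simp only [D]; ring
      have := h0'.comp_sub_const t t
      convert! this using 1
      funext s
      congr 1
      rw [add_assoc, ← add_smul]; congr 2; ring
    exact (Real.hasDerivAt_mul_log (evidence_pos (A := A) (μ := μ) (a + t • d) y).ne').comp t h1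
  obtain ⟨C, hC0, hC⟩ := bH
  have key := (hasDerivAt_integral_of_dominated_loc_of_deriv_le (μ := stdGaussianPi n)
    (x₀ := (0 : ℝ))
    (F := fun t y => evidence A μ (a + t • d) y * Real.log (evidence A μ (a + t • d) y))
    (F' := fun t y => H (a + t • d) y)
    (bound := fun y => Real.exp (C * (1 + ‖y‖))) (Metric.ball_mem_nhds (0 : ℝ) one_pos)
    (Filter.Eventually.of_forall fun t =>
      (mZ _).mul (aestronglyMeasurable_log_evidence _))
    (by
      simp only [zero_smul, add_zero]
      exact ((expBddOn_likInt (A := A) hR hR0 hB continuous_const).mul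
        (expBddOn_log_evidence (A := A) hR hR0 hB)).integrable ha
          ((mZ _).mul (aestronglyMeasurable_log_evidence _)))
    (by simpa using mH)
    (ae_of_all _ fun y t ht => hC _ (hmem t ht) y)
    (by
      refine ((integrable_exp_mul_norm_stdGaussianPi n C).const_mul (Real.exp C)).congr
        (ae_of_all _ fun y => ?_)
      simp only
      rw [← Real.exp_add]; congr 1; ring)
    (ae_of_all _ fun y t _ => hderiv y t)).2
  simp only [zero_smul, add_zero] at key
  convert! key using 1
  simp only [H, Finset.mul_sum]
  rw [integral_finsetSum _ fun k _ => ilD k]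
  refine Finset.sum_congr rfl fun k _ => ?_
  rw [← integral_log_evidence_mul_firstMoment hA hR hR0 a k, ← integral_const_mul]
  refine integral_congr_ae (ae_of_all _ fun y => ?_)
  simp only [D]
  ring

/-- The derivative of the relative entropy of a bounded mixture along affine paths. -/
lemma hasDerivAt_mixEntropy [NeZero μ] (hA : Aᵀ * A = 1)
    (hR : ∀ᵐ u ∂μ, ∀ k, |u k| ≤ R) (hR0 : 0 ≤ R) (a d : Fin K → ℝ) (t : ℝ) :
    HasDerivAt (fun t : ℝ => mixEntropy A μ (a + t • d))
      (∑ k, d k * ((a + t • d) k * estimateEnergy A μ k (a + t • d))) t := by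
  have h0 := hasDerivAt_mixEntropy_zero hA hR hR0 (a + t • d) d
  rw [← sub_self t] at h0
  convert! h0.comp_sub_const t t using 1
  funext s
  congr 1
  rw [add_assoc, ← add_smul]; congr 2; ring

/-- The integrated form is the one that passes to the limit along cubes, since it involves only
values of `mixEntropy` and `estimateEnergy`. -/
lemma mixEntropy_sub_of_box [NeZero μ] (hA : Aᵀ * A = 1)
    (hR : ∀ᵐ u ∂μ, ∀ k, |u k| ≤ R) (hR0 : 0 ≤ R) (a d : Fin K → ℝ) :
    mixEntropy A μ (a + d) - mixEntropy A μ a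
      = ∫ t in (0 : ℝ)..1, ∑ k, d k * ((a + t • d) k * estimateEnergy A μ k (a + t • d)) := by
  rw [intervalIntegral.integral_eq_sub_of_hasDerivAt
    (fun t _ => hasDerivAt_mixEntropy hA hR hR0 a d t)]
  · simp
  · refine Continuous.intervalIntegrable ?_ _ _
    have hp : Continuous fun t : ℝ => a + t • d := by fun_prop
    refine continuous_finsetSum _ fun k _ => continuous_const.mul (Continuous.mul ?_ ?_)
    · exact (continuous_apply k).comp hp
    · exact (continuous_estimateEnergy hA
        (integrable_of_box (g := fun u : Fin K → ℝ => u k ^ 2) hR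
          ((continuous_apply k).pow 2))).comp hp

end Bounded

/-! ### The joint law of input and output -/

section Joint

variable {n K : ℕ} {A : Matrix (Fin n) (Fin K) ℝ} {α : Type*} {φ : α → Fin K → ℝ}

/-- The map from input and noise to input and output. -/
def channelMap (A : Matrix (Fin n) (Fin K) ℝ) (a : Fin K → ℝ) (φ : α → Fin K → ℝ)
    (q : α × (Fin n → ℝ)) : α × (Fin n → ℝ) :=
  (q.1, A *ᵥ (a * φ q.1) + q.2)

lemma mulVec_transpose_channelMap (hA : Aᵀ * A = 1) (a : Fin K → ℝ) (q : α × (Fin n → ℝ))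
    (k : Fin K) :
    (Aᵀ *ᵥ (channelMap A a φ q).2) k = a k * φ q.1 k + (Aᵀ *ᵥ q.2) k := by
  simp [channelMap, Matrix.mulVec_add, hA]

/-- At an output of the channel the quadratic terms combine to half the signal energy, plus a cross
term that is linear in the noise and has mean zero. -/
lemma logLik_channelMap (hA : Aᵀ * A = 1) (a : Fin K → ℝ) (q : α × (Fin n → ℝ)) :
    logLik A a (φ q.1) (channelMap A a φ q).2
      = ∑ k, (a k ^ 2 / 2 * φ q.1 k ^ 2 + a k * (φ q.1 k * (Aᵀ *ᵥ q.2) k)) := by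
  refine Finset.sum_congr rfl fun k _ => ?_
  rw [mulVec_transpose_channelMap hA]
  ring

variable [MeasurableSpace α] {ν : Measure α}

lemma measurable_channelMap (hφ : Measurable φ) (a : Fin K → ℝ) :
    Measurable (channelMap A a φ) := by
  have h : Continuous fun q : (Fin K → ℝ) × (Fin n → ℝ) => A *ᵥ (a * q.1) + q.2 := by
    unfold Matrix.mulVec dotProduct; fun_prop
  exact measurable_fst.prodMk (h.measurable.comp ((hφ.comp measurable_fst).prodMk measurable_snd))

lemma measurable_lik_comp (hφ : Measurable φ) (a : Fin K → ℝ) :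
    Measurable fun q : α × (Fin n → ℝ) => lik A a (φ q.1) q.2 :=
  (measurable_lik A a).comp ((hφ.comp measurable_fst).prodMk measurable_snd)

/-- For fixed input this is the translation formula for the Gaussian law; Tonelli assembles the
fibres. -/
lemma map_channelMap [SFinite ν] (hA : Aᵀ * A = 1) (hφ : Measurable φ) (a : Fin K → ℝ) :
    (ν.prod (stdGaussianPi n)).map (channelMap A a φ) = (ν.prod (stdGaussianPi n)).withDensity
      fun q => ENNReal.ofReal (lik A a (φ q.1) q.2) := by
  have hT := measurable_channelMap (A := A) hφ a
  have hL := (measurable_lik_comp (A := A) hφ a).ennreal_ofReal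
  refine Measure.ext_of_lintegral _ fun f hf => ?_
  rw [lintegral_map hf hT, lintegral_withDensity_eq_lintegral_mul _ hL hf,
    lintegral_prod _ (by fun_prop), lintegral_prod _ (hL.mul hf).aemeasurable]
  refine lintegral_congr fun s => ?_
  exact lintegral_comp_add_stdGaussianPi hA a (φ s) (f := fun y => f (s, y))
    (hf.comp measurable_prodMk_left)

/-- Both sides express integrability under the joint law, once through its density and once as an
image measure. The right side is explicit in the independent pair of input and noise. -/
lemma integrable_lik_mul_iff [SFinite ν] (hA : Aᵀ * A = 1) (hφ : Measurable φ) (a : Fin K → ℝ)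
    {f : α × (Fin n → ℝ) → ℝ} (hf : Measurable f) :
    Integrable (fun q => lik A a (φ q.1) q.2 * f q) (ν.prod (stdGaussianPi n)) ↔
      Integrable (fun q => f (channelMap A a φ q)) (ν.prod (stdGaussianPi n)) := by
  have h1 : Integrable (fun q => f (channelMap A a φ q)) (ν.prod (stdGaussianPi n)) ↔
      Integrable f ((ν.prod (stdGaussianPi n)).map (channelMap A a φ)) :=
    (integrable_map_measure hf.aestronglyMeasurable
      (measurable_channelMap hφ a).aemeasurable).symm
  rw [h1, map_channelMap hA hφ, integrable_withDensity_iff_integrable_smul₀'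
    (measurable_lik_comp hφ a).ennreal_ofReal.aemeasurable (by simp)]
  simp [ENNReal.toReal_ofReal (lik_pos A a _ _).le]

lemma integrable_mulVec_transpose (k : Fin K) :
    Integrable (fun y => (Aᵀ *ᵥ y) k) (stdGaussianPi n) :=
  (expBddOn_mulVec (A := A) Set.univ k).integrable (Set.mem_univ 0) (aestronglyMeasurable_mulVec k)

lemma integrable_mulVec_transpose_sq (k : Fin K) :
    Integrable (fun y => (Aᵀ *ᵥ y) k ^ 2) (stdGaussianPi n) := by
  simp_rw [pow_two]
  exact ((expBddOn_mulVec (A := A) Set.univ k).mul (expBddOn_mulVec Set.univ k)).integrable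
    (Set.mem_univ 0) ((aestronglyMeasurable_mulVec k).mul (aestronglyMeasurable_mulVec k))

lemma integral_mulVec_transpose (k : Fin K) : ∫ y, (Aᵀ *ᵥ y) k ∂stdGaussianPi n = 0 := by
  have e2 : ∀ y : Fin n → ℝ, (Aᵀ *ᵥ y) k = y ⬝ᵥ fun i => A i k := fun y => by
    simp only [Matrix.mulVec, dotProduct_comm]; rfl
  have h := integral_mul_dotProduct_stdGaussianPi (n := n) (f := fun _ => 1) (f' := fun _ => 0)
    (v := fun i => A i k) (fun y => hasDerivAt_const _ _)
    (integrable_const _) (integrable_const _)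
    (by simpa only [one_mul, ← e2] using integrable_mulVec_transpose k)
  simpa only [one_mul, ← e2, integral_zero] using h

lemma integrable_mulVec_sq_channelMap [IsFiniteMeasure ν] (hA : Aᵀ * A = 1)
    (a : Fin K → ℝ) {k : Fin K} (h1 : Integrable (fun s => φ s k) ν) (h2 : Integrable (fun s => φ s k ^ 2) ν) :
    Integrable (fun q => (Aᵀ *ᵥ (channelMap A a φ q).2) k ^ 2) (ν.prod (stdGaussianPi n)) := by
  simp_rw [mulVec_transpose_channelMap hA]
  have i1 : Integrable (fun q : α × (Fin n → ℝ) => φ q.1 k ^ 2) (ν.prod (stdGaussianPi n)) :=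
    h2.comp_fst _
  have i2 : Integrable (fun q : α × (Fin n → ℝ) => (Aᵀ *ᵥ q.2) k ^ 2)
      (ν.prod (stdGaussianPi n)) := (integrable_mulVec_transpose_sq k).comp_snd _
  have i3 : Integrable (fun q : α × (Fin n → ℝ) => φ q.1 k * (Aᵀ *ᵥ q.2) k)
      (ν.prod (stdGaussianPi n)) := h1.mul_prod (integrable_mulVec_transpose k)
  refine (((i1.const_mul (a k ^ 2)).add (i3.const_mul (2 * a k))).add i2).congr
    (ae_of_all _ fun q => ?_)
  simp only [Pi.add_apply]
  ring

lemma integrable_logLik_channelMap [SFinite ν] (hA : Aᵀ * A = 1) (a : Fin K → ℝ)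
    (h1 : ∀ k, Integrable (fun s => φ s k) ν) (h2 : ∀ k, Integrable (fun s => φ s k ^ 2) ν) :
    Integrable (fun q => logLik A a (φ q.1) (channelMap A a φ q).2)
      (ν.prod (stdGaussianPi n)) := by
  simp_rw [logLik_channelMap hA]
  exact integrable_finsetSum _ fun k _ => (((h2 k).comp_fst _).const_mul _).add
    (((h1 k).mul_prod (integrable_mulVec_transpose k)).const_mul _)

lemma integral_logLik_channelMap [IsFiniteMeasure ν] (hA : Aᵀ * A = 1) (a : Fin K → ℝ)
    (h1 : ∀ k, Integrable (fun s => φ s k) ν) (h2 : ∀ k, Integrable (fun s => φ s k ^ 2) ν) :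
    ∫ q, logLik A a (φ q.1) (channelMap A a φ q).2 ∂ν.prod (stdGaussianPi n)
      = ∑ k, a k ^ 2 / 2 * ∫ s, φ s k ^ 2 ∂ν := by
  simp_rw [logLik_channelMap hA]
  have i1 : ∀ k, Integrable (fun q : α × (Fin n → ℝ) => a k ^ 2 / 2 * φ q.1 k ^ 2)
      (ν.prod (stdGaussianPi n)) := fun k => ((h2 k).comp_fst _).const_mul _
  have i2 : ∀ k, Integrable (fun q : α × (Fin n → ℝ) => a k * (φ q.1 k * (Aᵀ *ᵥ q.2) k))
      (ν.prod (stdGaussianPi n)) := fun k =>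
    ((h1 k).mul_prod (integrable_mulVec_transpose k)).const_mul _
  rw [integral_finsetSum (f := fun k (q : α × (Fin n → ℝ)) =>
    a k ^ 2 / 2 * φ q.1 k ^ 2 + a k * (φ q.1 k * (Aᵀ *ᵥ q.2) k)) _ fun k _ => (i1 k).add (i2 k)]
  refine Finset.sum_congr rfl fun k _ => ?_
  have e1 : ∫ q : α × (Fin n → ℝ), φ q.1 k ^ 2 ∂ν.prod (stdGaussianPi n) = ∫ s, φ s k ^ 2 ∂ν := by
    simpa using integral_prod_mul (μ := ν) (ν := stdGaussianPi n) (fun s => φ s k ^ 2) fun _ => 1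
  rw [integral_add (i1 k) (i2 k), integral_const_mul, integral_const_mul,
    integral_prod_mul (μ := ν) (ν := stdGaussianPi n) (fun s => φ s k) fun y => (Aᵀ *ᵥ y) k,
    integral_mulVec_transpose, e1]
  ring

end Joint

/-! ### The entropy of a mixture with finite second moments -/

section Entropy

variable {n K : ℕ} {A : Matrix (Fin n) (Fin K) ℝ} {μ : Measure (Fin K → ℝ)}

lemma evidence_le [IsProbabilityMeasure μ] (a : Fin K → ℝ) (y : Fin n → ℝ) :
    evidence A μ a y ≤ Real.exp (∑ k, (Aᵀ *ᵥ y) k ^ 2 / 2) := by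
  have h := integral_mono (integrable_mul_lik (A := A) (integrable_const (μ := μ) (1 : ℝ)) a y)
    (integrable_const (Real.exp (∑ k, (Aᵀ *ᵥ y) k ^ 2 / 2)))
    fun u => by simpa using lik_le A a u y
  simpa [likInt] using h

/-- From below, `Z log Z ≥ Z - 1 ≥ -1`. From above, `log Z` is at most half of `∑ (Aᵀ y)_k²`, whose
integral against `Z dγ` is a second moment of the output, hence finite. -/
lemma integrable_evidence_mul_log [IsProbabilityMeasure μ] (hA : Aᵀ * A = 1)
    (h2 : ∀ k, Integrable (fun u => u k ^ 2) μ) (a : Fin K → ℝ) :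
    Integrable (fun y => evidence A μ a y * Real.log (evidence A μ a y)) (stdGaussianPi n) := by
  have i1 : ∀ k, Integrable (fun q : (Fin K → ℝ) × (Fin n → ℝ) =>
      lik A a q.1 q.2 * (Aᵀ *ᵥ q.2) k ^ 2) (μ.prod (stdGaussianPi n)) := fun k =>
    (integrable_lik_mul_iff (φ := id) (ν := μ) hA measurable_id a
      (f := fun q => (Aᵀ *ᵥ q.2) k ^ 2) (by unfold Matrix.mulVec dotProduct; fun_prop)).2
      (integrable_mulVec_sq_channelMap hA a (integrable_apply_of_sq (h2 k)) (h2 k))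
  have i2 : ∀ k, Integrable (fun y => evidence A μ a y * (Aᵀ *ᵥ y) k ^ 2) (stdGaussianPi n) := by
    intro k
    refine (i1 k).integral_prod_right.congr (ae_of_all _ fun y => ?_)
    simp only [evidence, likInt, one_mul]
    rw [integral_mul_const]
  have i3 : Integrable (fun y => 1 + ∑ k, evidence A μ a y * (Aᵀ *ᵥ y) k ^ 2) (stdGaussianPi n) :=
    (integrable_const 1).add (integrable_finsetSum _ fun k _ => i2 k)
  refine i3.mono' ((aestronglyMeasurable_likInt aestronglyMeasurable_const a).mul
    (aestronglyMeasurable_log_evidence a)) (ae_of_all _ fun y => ?_)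
  have hZ := evidence_pos (A := A) (μ := μ) a y
  have hlog : Real.log (evidence A μ a y) ≤ ∑ k, (Aᵀ *ᵥ y) k ^ 2 / 2 := by
    rw [← Real.log_exp (∑ k, (Aᵀ *ᵥ y) k ^ 2 / 2)]
    exact Real.log_le_log hZ (evidence_le a y)
  have hS : ∑ k, (Aᵀ *ᵥ y) k ^ 2 / 2 ≤ ∑ k, (Aᵀ *ᵥ y) k ^ 2 :=
    Finset.sum_le_sum fun k _ => by linarith [sq_nonneg ((Aᵀ *ᵥ y) k)]
  have hS0 : 0 ≤ ∑ k, (Aᵀ *ᵥ y) k ^ 2 := by positivity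
  have hlow := Real.self_sub_one_le_mul_log hZ.le
  rw [Real.norm_eq_abs, abs_le, ← Finset.mul_sum]
  constructor
  · nlinarith [mul_nonneg hZ.le hS0]
  · nlinarith [mul_le_mul_of_nonneg_left (hlog.trans hS) hZ.le]

/-! ### Exhaustion by cubes, and the derivative in the squared amplitudes. -/

open Filter Topology

/-- The cube of half-width `m`. -/
def cube (K m : ℕ) : Set (Fin K → ℝ) := {u | ∀ k, |u k| ≤ m}

lemma measurableSet_cube (K m : ℕ) : MeasurableSet (cube K m) := by
  have : IsClosed (cube K m) := by
    simp only [cube, Set.ofPred_forall]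
    exact isClosed_iInter fun k => isClosed_le (by fun_prop) continuous_const
  exact this.measurableSet

lemma monotone_cube (K : ℕ) : Monotone (cube K) := fun _ _ h _ hu k =>
  (hu k).trans (Nat.cast_le.2 h)

lemma iUnion_cube (K : ℕ) : ⋃ m, cube K m = Set.univ := by
  refine Set.eq_univ_of_forall fun u => Set.mem_iUnion.2 ?_
  obtain ⟨m, hm⟩ := exists_nat_ge ‖u‖
  exact ⟨m, fun k => (norm_le_pi_norm u k).trans hm⟩

lemma ae_restrict_cube (μ : Measure (Fin K → ℝ)) (m : ℕ) :
    ∀ᵐ u ∂μ.restrict (cube K m), ∀ k, |u k| ≤ (m : ℝ) := ae_restrict_mem (measurableSet_cube K m)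

lemma tendsto_likInt_cube {g : (Fin K → ℝ) → ℝ} (hg : Integrable g μ) (a : Fin K → ℝ)
    (y : Fin n → ℝ) :
    Tendsto (fun m => likInt A (μ.restrict (cube K m)) g a y) atTop (𝓝 (likInt A μ g a y)) := by
  have h := tendsto_setIntegral_of_monotone (μ := μ) (f := fun u => g u * lik A a u y)
    (fun m => measurableSet_cube K m) (monotone_cube K) (integrable_mul_lik hg a y).integrableOn
  rwa [iUnion_cube, setIntegral_univ] at h

lemma likInt_cube_le {g : (Fin K → ℝ) → ℝ} (hg : Integrable g μ) (h0 : ∀ u, 0 ≤ g u)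
    (a : Fin K → ℝ) (y : Fin n → ℝ) (m : ℕ) :
    likInt A (μ.restrict (cube K m)) g a y ≤ likInt A μ g a y :=
  setIntegral_le_integral (integrable_mul_lik hg a y)
    (ae_of_all _ fun u => mul_nonneg (h0 u) (lik_pos A a u y).le)

/-- `x log x` is not monotone on `[0, 1]`, but there it lies in `[-1, 0]`; the summand `1` covers
this range. Above `1` monotonicity suffices. -/
lemma abs_mul_log_le {x z : ℝ} (hx : 0 ≤ x) (hxz : x ≤ z) :
    |x * Real.log x| ≤ 1 + |z * Real.log z| := by
  rcases le_total x 1 with h | h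
  · have h1 := Real.mul_log_nonpos hx h
    rw [abs_of_nonpos h1]
    linarith [Real.self_sub_one_le_mul_log hx, abs_nonneg (z * Real.log z)]
  · rw [abs_of_nonneg (Real.mul_log_nonneg h)]
    have h1 : x * Real.log x ≤ z * Real.log z :=
      mul_le_mul hxz (Real.log_le_log (by linarith) hxz) (Real.log_nonneg h) (by linarith)
    linarith [le_abs_self (z * Real.log z)]

lemma eventually_restrict_cube_ne_zero [NeZero μ] :
    ∀ᶠ m in atTop, μ.restrict (cube K m) ≠ 0 := by
  have h := tendsto_measure_iUnion_atTop (μ := μ) (monotone_cube K)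
  rw [iUnion_cube] at h
  filter_upwards [h.eventually (lt_mem_nhds (Measure.measure_univ_pos.2 (NeZero.ne μ)))] with m hm h0
  rw [Measure.restrict_eq_zero] at h0
  exact hm.ne' h0

variable [IsFiniteMeasure μ]

/-- The restrictions are left unnormalised, so their evidences stay below that of `μ` and the
entropy integrands have a common integrable bound. -/
lemma tendsto_mixEntropy_cube
    {a : Fin K → ℝ} (hi : Integrable (fun y => evidence A μ a y * Real.log (evidence A μ a y))
      (stdGaussianPi n)) :
    Tendsto (fun m => mixEntropy A (μ.restrict (cube K m)) a) atTop (𝓝 (mixEntropy A μ a)) := by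
  refine tendsto_integral_of_dominated_convergence
    (fun y => 1 + |evidence A μ a y * Real.log (evidence A μ a y)|)
    (fun m => (aestronglyMeasurable_likInt aestronglyMeasurable_const a).mul
      (aestronglyMeasurable_log_evidence a)) ((integrable_const 1).add hi.abs)
    (fun m => ae_of_all _ fun y => ?_) (ae_of_all _ fun y => ?_)
  · exact abs_mul_log_le (likInt_nonneg (fun _ => zero_le_one) a y)
      (likInt_cube_le (integrable_const 1) (fun _ => zero_le_one) a y m)
  · exact (Real.continuous_mul_log.tendsto _).comp (tendsto_likInt_cube (integrable_const 1) a y)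

lemma tendsto_estimateEnergy_cube [NeZero μ] (hA : Aᵀ * A = 1) {k : Fin K}
    (hk : Integrable (fun u => u k ^ 2) μ) (a : Fin K → ℝ) :
    Tendsto (fun m => estimateEnergy A (μ.restrict (cube K m)) k a) atTop
      (𝓝 (estimateEnergy A μ k a)) := by
  refine tendsto_integral_of_dominated_convergence (secondMoment A μ k a)
    (fun m => aestronglyMeasurable_firstMoment_sq_div k a) (integrable_likInt hA hk a)
    (fun m => ae_of_all _ fun y => ?_) (ae_of_all _ fun y => ?_)
  · rw [Real.norm_of_nonneg (firstMoment_sq_div_nonneg k a y)]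
    exact (firstMoment_sq_div_le hk.restrict a y).trans
      (likInt_cube_le hk (fun u => sq_nonneg _) a y m)
  · exact ((tendsto_likInt_cube (integrable_apply_of_sq hk) a y).pow 2).div
      (tendsto_likInt_cube (integrable_const 1) a y) (evidence_pos a y).ne'

/-- The fundamental theorem of calculus for the relative entropy of a mixture. -/
lemma mixEntropy_sub [NeZero μ] (hA : Aᵀ * A = 1) (h2 : ∀ k, Integrable (fun u => u k ^ 2) μ)
    (hi : ∀ a, Integrable (fun y => evidence A μ a y * Real.log (evidence A μ a y))
      (stdGaussianPi n)) (a d : Fin K → ℝ) :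
    mixEntropy A μ (a + d) - mixEntropy A μ a
      = ∫ t in (0 : ℝ)..1, ∑ k, d k * ((a + t • d) k * estimateEnergy A μ k (a + t • d)) := by
  have hl := (tendsto_mixEntropy_cube (hi (a + d))).sub (tendsto_mixEntropy_cube (hi a))
  have hr : Tendsto (fun m : ℕ => ∫ t in (0 : ℝ)..1, ∑ k, d k * ((a + t • d) k *
      estimateEnergy A (μ.restrict (cube K m)) k (a + t • d))) atTop
      (𝓝 (∫ t in (0 : ℝ)..1, ∑ k, d k * ((a + t • d) k * estimateEnergy A μ k (a + t • d)))) := by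
    -- The energies of all restrictions are at most the second moment of `μ`, which gives a bound
    -- that is constant in `t`.
    refine intervalIntegral.tendsto_integral_filter_of_dominated_convergence
      (fun _ => ∑ k, |d k| * ((|a k| + |d k|) * ∫ u, u k ^ 2 ∂μ)) ?_ ?_
      intervalIntegrable_const ?_
    · filter_upwards [eventually_restrict_cube_ne_zero (μ := μ)] with m hm
      have : NeZero (μ.restrict (cube K m)) := ⟨hm⟩
      refine Continuous.aestronglyMeasurable ?_
      have hp : Continuous fun t : ℝ => a + t • d := by fun_prop
      refine continuous_finsetSum _ fun k _ => continuous_const.mul (Continuous.mul ?_ ?_)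
      · exact (continuous_apply k).comp hp
      · exact (continuous_estimateEnergy hA (h2 k).restrict).comp hp
    · refine Eventually.of_forall fun m => ae_of_all _ fun t ht => ?_
      rw [Set.uIoc_of_le zero_le_one] at ht
      refine (Finset.abs_sum_le_sum_abs _ _).trans (Finset.sum_le_sum fun k _ => ?_)
      rw [abs_mul, abs_mul, abs_of_nonneg (estimateEnergy_nonneg k _)]
      have h3 : |(a + t • d) k| ≤ |a k| + |d k| := by
        refine (abs_add_le _ _).trans ?_
        refine add_le_add_right ?_ _
        rw [Pi.smul_apply, smul_eq_mul, abs_mul, abs_of_pos ht.1]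
        exact mul_le_of_le_one_left (abs_nonneg _) ht.2
      have h4 := (estimateEnergy_le hA (μ := μ.restrict (cube K m)) (h2 k).restrict
        (a + t • d)).trans (setIntegral_le_integral (h2 k) (ae_of_all _ fun u => sq_nonneg _))
      gcongr
      exact estimateEnergy_nonneg k _
    · refine ae_of_all _ fun t _ => tendsto_finsetSum _ fun k _ => ?_
      exact (((tendsto_estimateEnergy_cube hA (h2 k) (a + t • d)).const_mul _).const_mul _)
  refine tendsto_nhds_unique (hl.congr' ?_) hr
  filter_upwards [eventually_restrict_cube_ne_zero (μ := μ)] with m hm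
  have : NeZero (μ.restrict (cube K m)) := ⟨hm⟩
  exact mixEntropy_sub_of_box hA (ae_restrict_cube μ m) (Nat.cast_nonneg m) a d

/-- The derivative of the relative entropy with respect to the squared amplitudes, relative to the
nonnegative orthant. -/
lemma hasFDerivWithinAt_mixEntropy [NeZero μ] (hA : Aᵀ * A = 1)
    (h2 : ∀ k, Integrable (fun u => u k ^ 2) μ)
    (hi : ∀ a, Integrable (fun y => evidence A μ a y * Real.log (evidence A μ a y))
      (stdGaussianPi n)) {lam : Fin K → ℝ} (hlam : ∀ k, 0 ≤ lam k) {p : Fin K → ℝ}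
    (hp : ∀ k, 0 ≤ p k) :
    HasFDerivWithinAt (fun q : Fin K → ℝ => mixEntropy A μ fun k => lam k * Real.sqrt (q k))
      (rowMap fun k => lam k ^ 2 / 2 * estimateEnergy A μ k fun k => lam k * Real.sqrt (p k))
      (Set.Ici 0) p := by
  set amp : (Fin K → ℝ) → Fin K → ℝ := fun q k => lam k * Real.sqrt (q k) with hamp
  set a := amp p with ha
  have hampc : Continuous amp := by fun_prop
  have hM : ∀ k, Continuous (estimateEnergy A μ k) := fun k => continuous_estimateEnergy hA (h2 k)
  rw [hasFDerivWithinAt_iff_isLittleO, Asymptotics.isLittleO_iff]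
  intro c hc
  set Λ := ∑ k, lam k ^ 2 with hΛ
  have hΛ0 : 0 ≤ Λ := by positivity
  -- The component errors will be weighted by `lam k ^ 2`, with sum `Λ`; the `+ 1` covers `Λ = 0`.
  obtain ⟨δ, hδ, hball⟩ : ∃ δ > 0, ∀ b ∈ Metric.ball a δ, ∀ k,
      |estimateEnergy A μ k b - estimateEnergy A μ k a| < c / (Λ + 1) := by
    have : ∀ᶠ b in 𝓝 a, ∀ k, |estimateEnergy A μ k b - estimateEnergy A μ k a| < c / (Λ + 1) :=
      eventually_all.2 fun k => Metric.tendsto_nhds.1 ((hM k).tendsto a) _ (by positivity)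
    exact Metric.eventually_nhds_iff_ball.1 this
  have hnear : ∀ᶠ q in 𝓝[Set.Ici 0] p, amp q ∈ Metric.ball a δ :=
    (hampc.tendsto p).mono_left nhdsWithin_le_nhds (Metric.ball_mem_nhds a hδ)
  filter_upwards [hnear, self_mem_nhdsWithin] with q hq hq0
  have hq0 : ∀ k, 0 ≤ q k := hq0
  set d := amp q - a with hd
  have had : a + d = amp q := by rw [hd]; abel
  have hsub := mixEntropy_sub hA h2 hi a d
  rw [had] at hsub
  have hpc : Continuous fun t : ℝ => a + t • d := by fun_prop
  have hsq : ∀ k, lam k ^ 2 / 2 * (q k - p k) = a k * d k + d k ^ 2 / 2 := by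
    intro k
    have h1 : (amp q k) ^ 2 = lam k ^ 2 * q k := by
      simp only [hamp, mul_pow, Real.sq_sqrt (hq0 k)]
    have h2 : (a k) ^ 2 = lam k ^ 2 * p k := by
      simp only [ha, hamp, mul_pow, Real.sq_sqrt (hp k)]
    have h3 : d k = amp q k - a k := rfl
    rw [h3]; linear_combination (1 / 2) * h2 - (1 / 2) * h1
  -- Since `a_k² = lam_k² p_k`, the linear form equals exactly the same path integral with
  -- `estimateEnergy` frozen at `a`. The remainder is thus only the variation of `estimateEnergy`
  -- along the segment.
  have hlin : (rowMap fun k => lam k ^ 2 / 2 * estimateEnergy A μ k a) (q - p)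
      = ∫ t in (0 : ℝ)..1, ∑ k, d k * ((a + t • d) k * estimateEnergy A μ k a) := by
    rw [intervalIntegral.integral_finsetSum]
    · simp only [rowMap, sum_apply, smul_apply,
        ContinuousLinearMap.proj_apply, smul_eq_mul, Pi.sub_apply]
      refine Finset.sum_congr rfl fun k _ => ?_
      have : ∀ t : ℝ, d k * ((a + t • d) k * estimateEnergy A μ k a)
          = d k * estimateEnergy A μ k a * a k + d k ^ 2 * estimateEnergy A μ k a * t := fun t => by
        simp only [Pi.add_apply, Pi.smul_apply, smul_eq_mul]; ring
      simp_rw [this]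
      rw [intervalIntegral.integral_add (by simp)
        (Continuous.intervalIntegrable (by fun_prop) _ _),
        intervalIntegral.integral_const, intervalIntegral.integral_const_mul, integral_id,
        smul_eq_mul]
      linear_combination estimateEnergy A μ k a * hsq k
    · intro k _
      refine Continuous.intervalIntegrable ?_ _ _
      fun_prop
  rw [hsub, hlin, ← intervalIntegral.integral_sub]
  rotate_left
  · refine Continuous.intervalIntegrable ?_ _ _
    exact continuous_finsetSum _ fun k _ => continuous_const.mul
      (((continuous_apply k).comp hpc).mul ((hM k).comp hpc))
  · refine Continuous.intervalIntegrable ?_ _ _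
    fun_prop
  have hbound : ∀ t ∈ Set.uIoc (0 : ℝ) 1,
      ‖(∑ k, d k * ((a + t • d) k * estimateEnergy A μ k (a + t • d)))
        - ∑ k, d k * ((a + t • d) k * estimateEnergy A μ k a)‖ ≤ c * ‖q - p‖ := by
    intro t ht
    rw [Set.uIoc_of_le zero_le_one] at ht
    have hct : a + t • d ∈ Metric.ball a δ := by
      have := (convex_ball a δ).add_smul_sub_mem (Metric.mem_ball_self hδ) hq ⟨ht.1.le, ht.2⟩
      exact this
    rw [← Finset.sum_sub_distrib]
    have hterm : ∀ k, ‖d k * ((a + t • d) k * estimateEnergy A μ k (a + t • d))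
        - d k * ((a + t • d) k * estimateEnergy A μ k a)‖
        ≤ lam k ^ 2 * (c / (Λ + 1) * ‖q - p‖) := by
      intro k
      have e : d k * ((a + t • d) k * estimateEnergy A μ k (a + t • d))
        - d k * ((a + t • d) k * estimateEnergy A μ k a) = d k * (a + t • d) k *
          (estimateEnergy A μ k (a + t • d) - estimateEnergy A μ k a) := by ring
      have ha0 : 0 ≤ a k := mul_nonneg (hlam k) (Real.sqrt_nonneg _)
      have hb0 : 0 ≤ a k + d k := by
        have : (a + d) k = amp q k := by rw [had]
        rw [← Pi.add_apply, this]
        exact mul_nonneg (hlam k) (Real.sqrt_nonneg _)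
      -- Both end amplitudes are nonnegative, so `0 ≤ a_k + t d_k ≤ 2 a_k + d_k`, and `d_k (2 a_k +
      -- d_k)` is the difference of squares `lam_k² (q_k - p_k)`. The square root leaves no singular
      -- factor when `p_k = 0`.
      have h3 : |d k * (a + t • d) k| ≤ lam k ^ 2 * |q k - p k| := by
        have h4 : lam k ^ 2 * |q k - p k| = |d k * (2 * a k + d k)| := by
          rw [← abs_of_nonneg (sq_nonneg (lam k)), ← abs_mul]
          congr 1
          linear_combination 2 * hsq k
        rw [h4, abs_mul, abs_mul]
        refine mul_le_mul_of_nonneg_left ?_ (abs_nonneg _)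
        simp only [Pi.add_apply, Pi.smul_apply, smul_eq_mul]
        have h5 : 0 ≤ a k + t * d k := by nlinarith [ht.1, ht.2]
        rw [abs_of_nonneg h5, abs_of_nonneg (by linarith)]
        nlinarith [ht.1, ht.2]
      have h6 : |q k - p k| ≤ ‖q - p‖ := norm_le_pi_norm (q - p) k
      rw [e, norm_mul, Real.norm_eq_abs, Real.norm_eq_abs]
      calc _ ≤ lam k ^ 2 * |q k - p k| * (c / (Λ + 1)) :=
            mul_le_mul h3 (hball _ hct k).le (abs_nonneg _) (by positivity)
        _ ≤ lam k ^ 2 * ‖q - p‖ * (c / (Λ + 1)) := by gcongr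
        _ = _ := by ring
    refine (norm_sum_le _ _).trans ((Finset.sum_le_sum fun k _ => hterm k).trans ?_)
    rw [← Finset.sum_mul]
    have h7 : Λ * (c / (Λ + 1)) ≤ c := by
      rw [mul_div_assoc', div_le_iff₀ (by positivity)]; nlinarith
    calc Λ * (c / (Λ + 1) * ‖q - p‖) = Λ * (c / (Λ + 1)) * ‖q - p‖ := by ring
      _ ≤ c * ‖q - p‖ := by gcongr
  simpa using intervalIntegral.norm_integral_le_of_norm_le_const hbound

end Entropy

/-! ### The law of the output -/

section Output

variable {n K : ℕ} {A : Matrix (Fin n) (Fin K) ℝ} {α : Type*} [MeasurableSpace α]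
  {ν : Measure α} {φ : α → Fin K → ℝ}

/-- The unnormalised posterior mean of `f`. -/
noncomputable def postInt (A : Matrix (Fin n) (Fin K) ℝ) (ν : Measure α) (φ : α → Fin K → ℝ)
    (a : Fin K → ℝ) (f : α → ℝ) (y : Fin n → ℝ) : ℝ :=
  ∫ s, f s * lik A a (φ s) y ∂ν

lemma likInt_map (hφ : Measurable φ) {g : (Fin K → ℝ) → ℝ} (hg : Measurable g) (a : Fin K → ℝ) :
    likInt A (ν.map φ) g a = postInt A ν φ a (g ∘ φ) := by
  funext y
  exact integral_map hφ.aemeasurable (hg.mul (measurable_lik_left A a y)).aestronglyMeasurable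

lemma evidence_map (hφ : Measurable φ) (a : Fin K → ℝ) :
    evidence A (ν.map φ) a = postInt A ν φ a fun _ => 1 :=
  likInt_map hφ measurable_const a

lemma measurable_postInt [SFinite ν] (hφ : Measurable φ) (a : Fin K → ℝ) {f : α → ℝ}
    (hf : Measurable f) : Measurable (postInt A ν φ a f) := by
  have h : StronglyMeasurable fun q : (Fin n → ℝ) × α => f q.2 * lik A a (φ q.2) q.1 :=
    ((hf.comp measurable_snd).mul
      ((measurable_lik_comp hφ a).comp measurable_swap)).stronglyMeasurable
  exact h.integral_prod_right.measurable

lemma lintegral_lik_eq_evidence [IsFiniteMeasure ν] (hφ : Measurable φ) (a : Fin K → ℝ)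
    (y : Fin n → ℝ) :
    ∫⁻ s, ENNReal.ofReal (lik A a (φ s) y) ∂ν = ENNReal.ofReal (evidence A (ν.map φ) a y) := by
  have hi : Integrable (fun s => lik A a (φ s) y) ν := by
    have := (integrable_mul_lik (A := A) (integrable_const (μ := ν.map φ) (1 : ℝ)) a y)
    simpa [Function.comp_def] using this.comp_measurable hφ
  rw [evidence_map hφ, postInt, ← ofReal_integral_eq_lintegral_ofReal
    (by simpa using hi) (ae_of_all _ fun s => by simpa using (lik_pos A a _ y).le)]
  simp

lemma measurable_evidence_map [SFinite ν] (hφ : Measurable φ) (a : Fin K → ℝ) :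
    Measurable (evidence A (ν.map φ) a) := by
  rw [evidence_map hφ]; exact measurable_postInt hφ a measurable_const

lemma map_snd_channelMap [IsFiniteMeasure ν] (hA : Aᵀ * A = 1) (hφ : Measurable φ)
    (a : Fin K → ℝ) :
    ((ν.prod (stdGaussianPi n)).map (channelMap A a φ)).map Prod.snd
      = (stdGaussianPi n).withDensity fun y => ENNReal.ofReal (evidence A (ν.map φ) a y) := by
  have hL := (measurable_lik_comp (A := A) hφ a).ennreal_ofReal
  refine Measure.ext_of_lintegral _ fun f hf => ?_
  rw [lintegral_map hf measurable_snd, map_channelMap hA hφ,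
    lintegral_withDensity_eq_lintegral_mul _ hL (by fun_prop),
    lintegral_withDensity_eq_lintegral_mul _ (measurable_evidence_map hφ a).ennreal_ofReal hf,
    lintegral_prod_symm _ (by exact (hL.mul (hf.comp measurable_snd)).aemeasurable)]
  refine lintegral_congr fun y => ?_
  simp only [Pi.mul_apply]
  have hLy : Measurable fun s => ENNReal.ofReal (lik A a (φ s) y) :=
    ((measurable_lik_left A a y).comp hφ).ennreal_ofReal
  rw [lintegral_mul_const _ hLy, lintegral_lik_eq_evidence hφ]

/-- Relative to `ν × γ` the joint law has density `L` and the product of its marginals has density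
`Z`; as `Z` is positive everywhere, the quotient is a density of one with respect to the other. -/
lemma channelMap_eq_withDensity_prod [IsProbabilityMeasure ν] (hA : Aᵀ * A = 1)
    (hφ : Measurable φ) (a : Fin K → ℝ) :
    (ν.prod (stdGaussianPi n)).map (channelMap A a φ)
      = (ν.prod (((ν.prod (stdGaussianPi n)).map (channelMap A a φ)).map Prod.snd)).withDensity
        fun q => ENNReal.ofReal (lik A a (φ q.1) q.2 / evidence A (ν.map φ) a q.2) := by
  have hZm := measurable_evidence_map (A := A) (ν := ν) hφ a
  have : IsProbabilityMeasure (ν.map φ) := Measure.isProbabilityMeasure_map hφ.aemeasurable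
  have hr : Measurable fun q : α × (Fin n → ℝ) =>
      ENNReal.ofReal (lik A a (φ q.1) q.2 / evidence A (ν.map φ) a q.2) :=
    ((measurable_lik_comp hφ a).div (hZm.comp measurable_snd)).ennreal_ofReal
  rw [map_snd_channelMap hA hφ, prod_withDensity_right hZm.ennreal_ofReal,
    ← withDensity_mul _ (by fun_prop) hr, map_channelMap hA hφ]
  congr 1
  funext q
  simp only [Pi.mul_apply]
  have hZ := evidence_pos (A := A) (μ := ν.map φ) a q.2
  rw [← ENNReal.ofReal_mul hZ.le, mul_div_cancel₀ _ hZ.ne']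

/-- The log-likelihood ratio is `log L - log Z`. Under the joint law the first term has half the
signal energy as its mean, and the second has mean `∫ Z log Z dγ`; integrability of both makes the
divergence finite. -/
lemma klDiv_channelMap [IsProbabilityMeasure ν] (hA : Aᵀ * A = 1) (hφ : Measurable φ)
    (a : Fin K → ℝ) (h2 : ∀ k, Integrable (fun u => u k ^ 2) (ν.map φ)) :
    InformationTheory.klDiv ((ν.prod (stdGaussianPi n)).map (channelMap A a φ))
        (ν.prod (((ν.prod (stdGaussianPi n)).map (channelMap A a φ)).map Prod.snd)) ≠ ∞ ∧
      (InformationTheory.klDiv ((ν.prod (stdGaussianPi n)).map (channelMap A a φ))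
        (ν.prod (((ν.prod (stdGaussianPi n)).map (channelMap A a φ)).map Prod.snd))).toReal
      = ∑ k, a k ^ 2 / 2 * ∫ u, u k ^ 2 ∂(ν.map φ) - mixEntropy A (ν.map φ) a := by
  have : IsProbabilityMeasure (ν.map φ) := Measure.isProbabilityMeasure_map hφ.aemeasurable
  have hT := measurable_channelMap (A := A) hφ a
  have hZm := measurable_evidence_map (A := A) (ν := ν) hφ a
  have hLm := measurable_lik_comp (A := A) hφ a
  set J := (ν.prod (stdGaussianPi n)).map (channelMap A a φ) with hJ
  have : IsProbabilityMeasure J := Measure.isProbabilityMeasure_map hT.aemeasurable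
  have : IsProbabilityMeasure (J.map Prod.snd) :=
    Measure.isProbabilityMeasure_map measurable_snd.aemeasurable
  set Q := ν.prod (J.map Prod.snd) with hQ
  have hJQ : J = Q.withDensity
      fun q => ENNReal.ofReal (lik A a (φ q.1) q.2 / evidence A (ν.map φ) a q.2) :=
    channelMap_eq_withDensity_prod hA hφ a
  have hac : J ≪ Q := by rw [hJQ]; exact withDensity_absolutelyContinuous _ _
  have hllr : llr J Q =ᵐ[J] fun q =>
      logLik A a (φ q.1) q.2 - Real.log (evidence A (ν.map φ) a q.2) := by
    refine hac.ae_le ?_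
    have hrn := Measure.rnDeriv_withDensity Q (f := fun q => ENNReal.ofReal
      (lik A a (φ q.1) q.2 / evidence A (ν.map φ) a q.2))
      (hLm.div (hZm.comp measurable_snd)).ennreal_ofReal
    rw [← hJQ] at hrn
    filter_upwards [hrn] with q hq
    have hZ := evidence_pos (A := A) (μ := ν.map φ) a q.2
    rw [llr, hq, ENNReal.toReal_ofReal (div_nonneg (lik_pos A a _ _).le hZ.le),
      Real.log_div (lik_pos A a _ _).ne' hZ.ne', lik, Real.log_exp]
  have h2' : ∀ k, Integrable (fun s => φ s k ^ 2) ν := fun k => (h2 k).comp_measurable hφ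
  have h1' : ∀ k, Integrable (fun s => φ s k) ν := fun k =>
    (integrable_apply_of_sq (h2 k)).comp_measurable hφ
  have hlogm : Measurable fun q : α × (Fin n → ℝ) => logLik A a (φ q.1) q.2 :=
    ((continuous_logLik A).comp (by fun_prop : Continuous fun q : (Fin K → ℝ) × (Fin n → ℝ) =>
      (a, q.1, q.2))).measurable.comp ((hφ.comp measurable_fst).prodMk measurable_snd)
  have hlogZm : Measurable fun y => Real.log (evidence A (ν.map φ) a y) := hZm.log
  have i1 : Integrable (fun q : α × (Fin n → ℝ) => logLik A a (φ q.1) q.2) J :=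
    (integrable_map_measure hlogm.aestronglyMeasurable hT.aemeasurable).2
      (integrable_logLik_channelMap hA a h1' h2')
  have e1 : ∫ q, logLik A a (φ q.1) q.2 ∂J = ∑ k, a k ^ 2 / 2 * ∫ u, u k ^ 2 ∂(ν.map φ) := by
    rw [hJ, integral_map hT.aemeasurable hlogm.aestronglyMeasurable]
    refine (integral_logLik_channelMap hA a h1' h2').trans (Finset.sum_congr rfl fun k _ => ?_)
    rw [integral_map hφ.aemeasurable (by exact (h2 k).aestronglyMeasurable)]
  have hent := integrable_evidence_mul_log hA h2 a
  have i2' : Integrable (fun y => Real.log (evidence A (ν.map φ) a y)) (J.map Prod.snd) := by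
    rw [map_snd_channelMap hA hφ, integrable_withDensity_iff_integrable_smul₀'
      hZm.ennreal_ofReal.aemeasurable (by simp)]
    refine hent.congr (ae_of_all _ fun y => ?_)
    simp only [smul_eq_mul]
    rw [ENNReal.toReal_ofReal (evidence_pos a y).le]
  have i2 : Integrable (fun q : α × (Fin n → ℝ) => Real.log (evidence A (ν.map φ) a q.2)) J :=
    i2'.comp_measurable measurable_snd
  have e2 : ∫ q : α × (Fin n → ℝ), Real.log (evidence A (ν.map φ) a q.2) ∂J
      = mixEntropy A (ν.map φ) a := by
    rw [← integral_map (f := fun y => Real.log (evidence A (ν.map φ) a y))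
      measurable_snd.aemeasurable hlogZm.aestronglyMeasurable,
      map_snd_channelMap hA hφ, integral_withDensity_eq_integral_toReal_smul
      hZm.ennreal_ofReal (by simp)]
    refine integral_congr_ae (ae_of_all _ fun y => ?_)
    simp only [smul_eq_mul]
    rw [ENNReal.toReal_ofReal (evidence_pos a y).le]
  refine ⟨InformationTheory.klDiv_ne_top hac ((i1.sub i2).congr hllr.symm), ?_⟩
  rw [InformationTheory.toReal_klDiv_of_measure_eq hac (by simp), integral_congr_ae hllr,
    integral_sub i1 i2, e1, e2]

end Output

/-! ### The conditional mean -/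

section CondMean

variable {n K : ℕ} {A : Matrix (Fin n) (Fin K) ℝ} {α Ω : Type*} [MeasurableSpace α]
  [MeasurableSpace Ω] {P : Measure Ω} [IsProbabilityMeasure P] {φ : α → Fin K → ℝ}
  {X : Ω → α} {w : Ω → Fin n → ℝ} {a : Fin K → ℝ}

lemma map_input_output (hX : Measurable X) (hw : Measurable w) (hlaw : P.map w = stdGaussianPi n)
    (hind : IndepFun X w P) (hφ : Measurable φ) :
    P.map (fun ω => (X ω, A *ᵥ (a * φ (X ω)) + w ω))
      = ((P.map X).prod (stdGaussianPi n)).map (channelMap A a φ) := by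
  rw [← hlaw, ← (indepFun_iff_map_prod_eq_prod_map_map hX.aemeasurable hw.aemeasurable).1 hind,
    Measure.map_map (measurable_channelMap hφ a) (hX.prodMk hw)]
  rfl

lemma measurable_output (hX : Measurable X) (hw : Measurable w) (hφ : Measurable φ) :
    Measurable fun ω => A *ᵥ (a * φ (X ω)) + w ω :=
  measurable_snd.comp ((measurable_channelMap (A := A) hφ a).comp (hX.prodMk hw))

lemma map_output (hA : Aᵀ * A = 1) (hX : Measurable X) (hw : Measurable w)
    (hlaw : P.map w = stdGaussianPi n) (hind : IndepFun X w P) (hφ : Measurable φ) :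
    P.map (fun ω => A *ᵥ (a * φ (X ω)) + w ω) = (stdGaussianPi n).withDensity
      fun y => ENNReal.ofReal (evidence A ((P.map X).map φ) a y) := by
  have : IsProbabilityMeasure (P.map X) := Measure.isProbabilityMeasure_map hX.aemeasurable
  rw [← map_snd_channelMap hA hφ a, ← map_input_output hX hw hlaw hind hφ,
    Measure.map_map measurable_snd (hX.prodMk (measurable_output hX hw hφ))]
  rfl

lemma mutualInfo_eq_klDiv (hX : Measurable X) (hw : Measurable w)
    (hlaw : P.map w = stdGaussianPi n) (hind : IndepFun X w P) (hφ : Measurable φ) :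
    mutualInfo P X (fun ω => A *ᵥ (a * φ (X ω)) + w ω)
      = InformationTheory.klDiv (((P.map X).prod (stdGaussianPi n)).map (channelMap A a φ))
        ((P.map X).prod
          ((((P.map X).prod (stdGaussianPi n)).map (channelMap A a φ)).map Prod.snd)) := by
  rw [mutualInfo, ← map_input_output hX hw hlaw hind hφ,
    Measure.map_map measurable_snd (hX.prodMk (measurable_output hX hw hφ))]
  rfl

/-- Bayes' rule: the conditional mean of `f(X)` given the output. -/
lemma condExp_comp_output (hA : Aᵀ * A = 1) (hX : Measurable X) (hw : Measurable w)
    (hlaw : P.map w = stdGaussianPi n) (hind : IndepFun X w P) (hφ : Measurable φ) {f : α → ℝ}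
    (hf : Measurable f) (hfi : Integrable f (P.map X)) :
    P[fun ω => f (X ω) | MeasurableSpace.comap (fun ω => A *ᵥ (a * φ (X ω)) + w ω) inferInstance]
      =ᵐ[P] fun ω => (fun y => postInt A (P.map X) φ a f y / evidence A ((P.map X).map φ) a y)
        (A *ᵥ (a * φ (X ω)) + w ω) := by
  have : IsProbabilityMeasure (P.map X) := Measure.isProbabilityMeasure_map hX.aemeasurable
  have : IsProbabilityMeasure ((P.map X).map φ) := Measure.isProbabilityMeasure_map hφ.aemeasurable
  have hYm := measurable_output (A := A) (a := a) hX hw hφ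
  have hlawY := map_output (A := A) (a := a) hA hX hw hlaw hind hφ
  have hjoint := map_input_output (A := A) (a := a) hX hw hlaw hind hφ
  set Y := fun ω => A *ᵥ (a * φ (X ω)) + w ω with hY
  set ν := P.map X with hν
  set Z := evidence A (ν.map φ) a with hZdef
  have hZm : Measurable Z := measurable_evidence_map hφ a
  have hZpos : ∀ y, 0 < Z y := fun y => evidence_pos a y
  have hNm : Measurable (postInt A ν φ a f) := measurable_postInt hφ a hf
  have hlikf : Integrable (fun q : α × (Fin n → ℝ) => lik A a (φ q.1) q.2 * f q.1)
      (ν.prod (stdGaussianPi n)) :=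
    (integrable_lik_mul_iff hA hφ a (hf.comp measurable_fst)).2 (hfi.comp_fst _)
  have hNi : Integrable (postInt A ν φ a f) (stdGaussianPi n) := by
    refine hlikf.integral_prod_right.congr (ae_of_all _ fun y => ?_)
    simp only [postInt, mul_comm]
  have hψi : Integrable (fun y => postInt A ν φ a f y / Z y) (P.map Y) := by
    rw [hlawY, integrable_withDensity_iff_integrable_smul₀'
      hZm.ennreal_ofReal.aemeasurable (by simp)]
    refine hNi.congr (ae_of_all _ fun y => ?_)
    simp only [smul_eq_mul]
    rw [ENNReal.toReal_ofReal (hZpos y).le, mul_div_cancel₀ _ (hZpos y).ne']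
  have hfX : Integrable (fun ω => f (X ω)) P := hfi.comp_measurable hX
  have hψY : Integrable (fun ω => postInt A ν φ a f (Y ω) / Z (Y ω)) P :=
    hψi.comp_measurable hYm
  refine (ae_eq_condExp_of_forall_setIntegral_eq hYm.comap_le hfX
    (fun s _ _ => hψY.integrableOn) ?_ ?_).symm
  -- Both integrals over the event that the output lies in `B` equal the Gaussian integral over `B`
  -- of the unnormalised posterior mean.
  · rintro s ⟨B, hB, rfl⟩ -
    have h1 : ∫ ω in Y ⁻¹' B, postInt A ν φ a f (Y ω) / Z (Y ω) ∂P
        = ∫ y in B, postInt A ν φ a f y ∂stdGaussianPi n := by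
      rw [← setIntegral_map (f := fun y => postInt A ν φ a f y / Z y) hB
        (hNm.div hZm).aestronglyMeasurable hYm.aemeasurable, hlawY,
        setIntegral_withDensity_eq_setIntegral_toReal_smul hZm.ennreal_ofReal
          (by simp) _ hB]
      refine setIntegral_congr_fun hB fun y _ => ?_
      simp only [smul_eq_mul]
      rw [ENNReal.toReal_ofReal (hZpos y).le, mul_div_cancel₀ _ (hZpos y).ne']
    have hBm : MeasurableSet (Prod.snd ⁻¹' B : Set (α × (Fin n → ℝ))) := measurable_snd hB
    have h2 : ∫ ω in Y ⁻¹' B, f (X ω) ∂P = ∫ y in B, postInt A ν φ a f y ∂stdGaussianPi n := by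
      have h3 : ∫ ω in Y ⁻¹' B, f (X ω) ∂P
          = ∫ q in (Prod.snd ⁻¹' B : Set (α × (Fin n → ℝ))), f q.1 ∂(P.map fun ω => (X ω, Y ω)) := by
        rw [setIntegral_map (f := fun q : α × (Fin n → ℝ) => f q.1) hBm (hf.comp measurable_fst).aestronglyMeasurable
          (hX.prodMk hYm).aemeasurable]
        rfl
      rw [h3, hjoint, map_channelMap hA hφ, setIntegral_withDensity_eq_setIntegral_toReal_smul
        (measurable_lik_comp hφ a).ennreal_ofReal (by simp) _ hBm,
        ← integral_indicator hBm, ← integral_indicator hB]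
      have h4 : ∀ q : α × (Fin n → ℝ), (Prod.snd ⁻¹' B : Set (α × (Fin n → ℝ))).indicator
          (fun q => (ENNReal.ofReal (lik A a (φ q.1) q.2)).toReal • f q.1) q
          = B.indicator (fun _ => 1) q.2 * (f q.1 * lik A a (φ q.1) q.2) := by
        intro q
        by_cases hq : q.2 ∈ B
        · have hq' : q ∈ (Prod.snd ⁻¹' B : Set (α × (Fin n → ℝ))) := hq
          rw [Set.indicator_of_mem hq', Set.indicator_of_mem hq,
            ENNReal.toReal_ofReal (lik_pos A a _ _).le, smul_eq_mul]
          ring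
        · have hq' : q ∉ (Prod.snd ⁻¹' B : Set (α × (Fin n → ℝ))) := hq
          rw [Set.indicator_of_notMem hq', Set.indicator_of_notMem hq, zero_mul]
      simp_rw [h4]
      rw [integral_prod_symm]
      · refine integral_congr_ae (ae_of_all _ fun y => ?_)
        simp only
        rw [integral_const_mul]
        by_cases hy : y ∈ B
        · simp [hy, postInt]
        · simp [hy]
      · refine (hlikf.indicator hBm).congr (ae_of_all _ fun q => ?_)
        by_cases hq : q.2 ∈ B
        · simp [Set.indicator, hq, mul_comm]
        · simp [Set.indicator, hq]
    exact h1.trans h2.symm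
  · exact ((hNm.div hZm).comp (comap_measurable Y)).aestronglyMeasurable

/-- The mean square error of the conditional mean. -/
lemma integral_sub_condExp_sq {Ω : Type*} {m m₀ : MeasurableSpace Ω} {P : Measure[m₀] Ω}
    [IsProbabilityMeasure P] (hm : m ≤ m₀) {u : Ω → ℝ} (hu : MemLp u 2 P) :
    ∫ ω, (u ω - (P[u | m]) ω) ^ 2 ∂P = ∫ ω, u ω ^ 2 ∂P - ∫ ω, (P[u | m]) ω ^ 2 ∂P := by
  have hc : MemLp (P[u | m]) 2 P := hu.condExp one_le_two
  have iu : Integrable (fun ω => u ω ^ 2) P := hu.integrable_sq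
  have ic : Integrable (fun ω => (P[u | m]) ω ^ 2) P := hc.integrable_sq
  have iuc : Integrable (fun ω => (P[u | m]) ω * u ω) P := hc.integrable_mul hu
  -- Pulling the conditional mean out of its own conditional expectation gives `E[c u] = E[c²]`.
  have horth : ∫ ω, (P[u | m]) ω * u ω ∂P = ∫ ω, (P[u | m]) ω ^ 2 ∂P := by
    rw [← integral_condExp hm]
    refine integral_congr_ae ?_
    refine (condExp_mul_of_stronglyMeasurable_left stronglyMeasurable_condExp iuc
      (hu.integrable (by norm_num))).trans (ae_of_all _ fun ω => ?_)
    simp only [Pi.mul_apply, pow_two]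
  have e : ∀ ω, (u ω - (P[u | m]) ω) ^ 2
      = u ω ^ 2 - 2 * ((P[u | m]) ω * u ω) + (P[u | m]) ω ^ 2 := fun ω => by ring
  simp_rw [e]
  rw [integral_add (f := fun ω => u ω ^ 2 - 2 * ((P[u | m]) ω * u ω)) (iu.sub (iuc.const_mul 2)) ic,
    integral_sub iu (iuc.const_mul 2), integral_const_mul, horth]
  ring

/-- The posterior mean is `N / Z` and the output has density `Z`, so its second moment is `∫ (N /
Z)² Z dγ = ∫ N² / Z dγ`. -/
lemma integral_condExp_output_sq (hA : Aᵀ * A = 1) (hX : Measurable X) (hw : Measurable w)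
    (hlaw : P.map w = stdGaussianPi n) (hind : IndepFun X w P) (hφ : Measurable φ) {k : Fin K}
    (hk : Integrable (fun ω => φ (X ω) k) P) :
    ∫ ω, (P[fun ω => φ (X ω) k | MeasurableSpace.comap
        (fun ω => A *ᵥ (a * φ (X ω)) + w ω) inferInstance]) ω ^ 2 ∂P
      = estimateEnergy A ((P.map X).map φ) k a := by
  have : IsProbabilityMeasure (P.map X) := Measure.isProbabilityMeasure_map hX.aemeasurable
  have : IsProbabilityMeasure ((P.map X).map φ) := Measure.isProbabilityMeasure_map hφ.aemeasurable
  have hφk : Measurable fun s => φ s k := (measurable_pi_apply k).comp hφ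
  have hYm := measurable_output (A := A) (a := a) hX hw hφ
  have hlawY := map_output (A := A) (a := a) hA hX hw hlaw hind hφ
  have hfi : Integrable (fun s => φ s k) (P.map X) :=
    (integrable_map_measure hφk.aestronglyMeasurable hX.aemeasurable).2 hk
  have hbayes := condExp_comp_output (A := A) (a := a) hA hX hw hlaw hind hφ hφk hfi
  have hZm := measurable_evidence_map (A := A) (ν := P.map X) hφ a
  have hNm : Measurable (postInt A (P.map X) φ a fun s => φ s k) := measurable_postInt hφ a hφk
  rw [integral_congr_ae (hbayes.mono fun ω hω => congrArg (· ^ 2) hω)]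
  simp only
  rw [← integral_map (f := fun y =>
      (postInt A (P.map X) φ a (fun s => φ s k) y / evidence A ((P.map X).map φ) a y) ^ 2)
    hYm.aemeasurable ((hNm.div hZm).pow_const 2).aestronglyMeasurable,
    hlawY, integral_withDensity_eq_integral_toReal_smul hZm.ennreal_ofReal (by simp)]
  refine integral_congr_ae (ae_of_all _ fun y => ?_)
  have hZ := evidence_pos (A := A) (μ := (P.map X).map φ) a y
  simp only [smul_eq_mul]
  rw [ENNReal.toReal_ofReal hZ.le, firstMoment, likInt_map hφ (measurable_pi_apply k)]
  simp only [Function.comp_def]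
  field_simp

end CondMean

/-! ### The rate and the gain matrix -/

section Rate

lemma integral_sum_mul_sq {Ω ι : Type*} [MeasurableSpace Ω] [Fintype ι] {P : Measure Ω}
    {D : ι → Ω → ℝ} (hD : ∀ i, MemLp (D i) 2 P) (c : ι → ℝ) :
    ∫ ω, (∑ i, c i * D i ω) ^ 2 ∂P = ∑ i, ∑ j, c i * c j * ∫ ω, D i ω * D j ω ∂P := by
  have e : ∀ ω, (∑ i, c i * D i ω) ^ 2 = ∑ i, ∑ j, c i * c j * (D i ω * D j ω) := fun ω => by
    rw [pow_two, Finset.sum_mul_sum]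
    exact Finset.sum_congr rfl fun i _ => Finset.sum_congr rfl fun j _ => by ring
  have hi : ∀ i j, Integrable (fun ω => c i * c j * (D i ω * D j ω)) P := fun i j =>
    ((hD i).integrable_mul (hD j)).const_mul _
  simp_rw [e]
  rw [integral_finsetSum _ fun i _ => integrable_finsetSum _ fun j _ => hi i j]
  refine Finset.sum_congr rfl fun i _ => ?_
  rw [integral_finsetSum _ fun j _ => hi i j]
  exact Finset.sum_congr rfl fun j _ => integral_const_mul _ _

/-- The rotation `Vᵀ` is moved onto the input, leaving orthonormal columns `VH` and scalar
amplitudes that carry all dependence on `p`. -/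
lemma received_effChannel {Ω : Type*} {nR K : ℕ} (s : Ω → Fin K → ℝ) (w : Ω → Fin nR → ℝ)
    (VH : Matrix (Fin nR) (Fin K) ℝ) (lam : Fin K → ℝ) (V : Matrix (Fin K) (Fin K) ℝ)
    (p : Fin K → ℝ) :
    received s w (effChannel VH lam V p)
      = fun ω => VH *ᵥ ((fun k => lam k * Real.sqrt (p k)) * (Vᵀ *ᵥ s ω)) + w ω := by
  funext ω
  simp only [received, effChannel, Matrix.mul_assoc, ← Matrix.mulVec_mulVec]
  congr 2
  funext k
  simp only [Matrix.mulVec_diagonal, Pi.mul_apply]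
  ring

lemma measurable_mulVec {m n : ℕ} (M : Matrix (Fin m) (Fin n) ℝ) :
    Measurable fun v : Fin n → ℝ => M *ᵥ v := by
  refine Continuous.measurable ?_
  unfold Matrix.mulVec dotProduct; fun_prop

variable {Ω : Type*} [MeasurableSpace Ω] {P : Measure Ω}
  {nR K : ℕ} {s : Ω → Fin K → ℝ} {w : Ω → Fin nR → ℝ} {VH : Matrix (Fin nR) (Fin K) ℝ}
  {lam : Fin K → ℝ} {V : Matrix (Fin K) (Fin K) ℝ}

lemma memLp_two_of_second_moment (hs : Measurable s)
    (h2 : ∀ k l, ∫ ω, s ω k * s ω l ∂P = if k = l then 1 else 0) (k : Fin K) :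
    MemLp (fun ω => s ω k) 2 P := by
  have hm : Measurable fun ω => s ω k := (measurable_pi_apply k).comp hs
  rw [memLp_two_iff_integrable_sq hm.aestronglyMeasurable]
  have h := h2 k k
  rw [if_pos rfl] at h
  simp_rw [pow_two]
  -- A non-integrable function would have integral `0`, not `1`.
  exact not_imp_comm.1 integral_undef (by rw [h]; exact one_ne_zero)

lemma memLp_mulVec {m : ℕ} (hs : ∀ k, MemLp (fun ω => s ω k) 2 P) (M : Matrix (Fin m) (Fin K) ℝ)
    (k : Fin m) : MemLp (fun ω => (M *ᵥ s ω) k) 2 P :=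
  memLp_finsetSum (f := fun i ω => M k i * s ω i) Finset.univ fun i _ => (hs i).const_mul _

lemma integral_mulVec_sq (hs : Measurable s)
    (h2 : ∀ k l, ∫ ω, s ω k * s ω l ∂P = if k = l then 1 else 0) (hV : Vᵀ * V = 1) (k : Fin K) :
    ∫ ω, (Vᵀ *ᵥ s ω) k ^ 2 ∂P = 1 := by
  have h := integral_sum_mul_sq (D := fun i ω => s ω i) (memLp_two_of_second_moment hs h2)
    (fun i => V i k)
  simp only [h2, mul_ite, mul_one, mul_zero, Finset.sum_ite_eq, Finset.mem_univ, if_true] at h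
  refine h.trans ?_
  have := congrFun (congrFun hV k) k
  rwa [Matrix.mul_apply, Matrix.one_apply_eq] at this

variable [IsProbabilityMeasure P]

/-- The diagonal entry of `Vᵀ E V` is the mean square error in estimating `(Vᵀ s)_k`, by linearity
of conditional expectation. Orthogonality of the error splits it as the variance `1` minus the
energy of the estimate. -/
lemma gainMatrix_diag (hs : Measurable s) (hw : Measurable w)
    (hlaw : P.map w = stdGaussianPi nR) (hind : IndepFun s w P)
    (h2 : ∀ k l, ∫ ω, s ω k * s ω l ∂P = if k = l then 1 else 0)
    (hVH : VHᵀ * VH = 1) (hV : Vᵀ * V = 1) (p : Fin K → ℝ) (k : Fin K) :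
    gainMatrix P s w VH lam V p k k = lam k ^ 2 * (1 - estimateEnergy VH
      ((P.map s).map fun v => Vᵀ *ᵥ v) k fun k => lam k * Real.sqrt (p k)) := by
  have hsL := memLp_two_of_second_moment hs h2
  have hφ : Measurable fun v : Fin K → ℝ => Vᵀ *ᵥ v := measurable_mulVec _
  have hYm := measurable_output (A := VH) (a := fun k => lam k * Real.sqrt (p k)) hs hw hφ
  have hD : ∀ i, MemLp (fun ω => s ω i - condMean P s
      (received s w (effChannel VH lam V p)) i ω) 2 P := fun i =>
    (hsL i).sub ((hsL i).condExp one_le_two)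
  have hgain : gainMatrix P s w VH lam V p k k = lam k ^ 2 * ∑ i, ∑ j, V i k * V j k *
      mmseMatrix P s (received s w (effChannel VH lam V p)) i j := by
    rw [gainMatrix, Matrix.diagonal_pow, Matrix.mul_assoc, Matrix.mul_assoc, Matrix.diagonal_mul]
    congr 1
    simp only [Matrix.mul_apply, Matrix.transpose_apply, Finset.mul_sum]
    exact Finset.sum_congr rfl fun i _ => Finset.sum_congr rfl fun j _ => by ring
  rw [hgain]
  simp only [mmseMatrix, Matrix.of_apply]
  rw [← integral_sum_mul_sq hD fun i => V i k]
  congr 1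
  rw [← integral_mulVec_sq hs h2 hV k, ← integral_condExp_output_sq hVH hs hw hlaw hind hφ
    ((memLp_mulVec hsL Vᵀ k).integrable (by norm_num)),
    ← integral_sub_condExp_sq hYm.comap_le (memLp_mulVec hsL Vᵀ k)]
  refine integral_congr_ae ?_
  have hlin : (P[fun ω => (Vᵀ *ᵥ s ω) k | MeasurableSpace.comap (fun ω => VH *ᵥ
      ((fun k => lam k * Real.sqrt (p k)) * (Vᵀ *ᵥ s ω)) + w ω) inferInstance])
      =ᵐ[P] ∑ i, V i k • condMean P s (received s w (effChannel VH lam V p)) i := by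
    have h1 : (fun ω => (Vᵀ *ᵥ s ω) k) = ∑ i, V i k • fun ω => s ω i := by
      funext ω
      simp [Matrix.mulVec, dotProduct]
    rw [h1]
    refine (condExp_finsetSum (fun i _ => ((hsL i).integrable (by norm_num)).smul _) _).trans ?_
    have h3 : ∀ i, (P[V i k • fun ω => s ω i | MeasurableSpace.comap (fun ω => VH *ᵥ
      ((fun k => lam k * Real.sqrt (p k)) * (Vᵀ *ᵥ s ω)) + w ω) inferInstance])
      =ᵐ[P] V i k • condMean P s (received s w (effChannel VH lam V p)) i := fun i => by
      rw [received_effChannel]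
      exact condExp_smul _ _ _
    filter_upwards [ae_all_iff.2 h3] with ω hω
    simp only [Finset.sum_apply, hω]
  filter_upwards [hlin] with ω hω
  rw [hω]
  simp only [Finset.sum_apply, Pi.smul_apply, smul_eq_mul, mul_sub, Finset.sum_sub_distrib]
  rfl

lemma mutualInfo_received (hs : Measurable s) (hw : Measurable w)
    (hlaw : P.map w = stdGaussianPi nR) (hind : IndepFun s w P)
    (h2 : ∀ k l, ∫ ω, s ω k * s ω l ∂P = if k = l then 1 else 0)
    (hVH : VHᵀ * VH = 1) (hV : Vᵀ * V = 1) {p : Fin K → ℝ} (hp : ∀ k, 0 ≤ p k) :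
    mutualInfo P s (received s w (effChannel VH lam V p)) ≠ ∞ ∧
      rate P s w VH lam V p = ∑ k, lam k ^ 2 / 2 * p k - mixEntropy VH
        ((P.map s).map fun v => Vᵀ *ᵥ v) fun k => lam k * Real.sqrt (p k) := by
  have hsL := memLp_two_of_second_moment hs h2
  have hφ : Measurable fun v : Fin K → ℝ => Vᵀ *ᵥ v := measurable_mulVec _
  have : IsProbabilityMeasure (P.map s) := Measure.isProbabilityMeasure_map hs.aemeasurable
  have hsq : ∀ k, AEStronglyMeasurable (fun u : Fin K → ℝ => u k ^ 2) (P.map fun ω => Vᵀ *ᵥ s ω) :=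
    fun k => ((measurable_pi_apply k).pow_const 2).aestronglyMeasurable
  have hφs : Measurable fun ω => Vᵀ *ᵥ s ω := hφ.comp hs
  have hmap : (P.map s).map (fun v => Vᵀ *ᵥ v) = P.map fun ω => Vᵀ *ᵥ s ω :=
    Measure.map_map hφ hs
  have h2' : ∀ k, Integrable (fun u => u k ^ 2) ((P.map s).map fun v => Vᵀ *ᵥ v) := fun k => by
    rw [hmap, integrable_map_measure (hsq k) hφs.aemeasurable]
    exact (memLp_mulVec hsL Vᵀ k).integrable_sq
  have h1 : ∀ k, ∫ u, u k ^ 2 ∂((P.map s).map fun v => Vᵀ *ᵥ v) = 1 := fun k => by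
    rw [hmap, integral_map hφs.aemeasurable (hsq k)]
    exact integral_mulVec_sq hs h2 hV k
  obtain ⟨hfin, hval⟩ := klDiv_channelMap (A := VH) (ν := P.map s) hVH hφ
    (fun k => lam k * Real.sqrt (p k)) h2'
  rw [rate, received_effChannel, mutualInfo_eq_klDiv hs hw hlaw hind hφ]
  refine ⟨hfin, hval.trans ?_⟩
  congr 1
  refine Finset.sum_congr rfl fun k _ => ?_
  rw [h1, mul_pow, Real.sq_sqrt (hp k)]
  ring

/-- The Jacobian of the mutual information with respect to the squared singular values. -/
lemma hasFDerivWithinAt_rate (hs : Measurable s) (hw : Measurable w)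
    (hlaw : P.map w = stdGaussianPi nR) (hind : IndepFun s w P)
    (h2 : ∀ k l, ∫ ω, s ω k * s ω l ∂P = if k = l then 1 else 0)
    (hVH : VHᵀ * VH = 1) (hV : Vᵀ * V = 1) (hlam : ∀ k, 0 ≤ lam k) {p : Fin K → ℝ}
    (hp : ∀ k, 0 ≤ p k) :
    HasFDerivWithinAt (rate P s w VH lam V)
      (rowMap ((1 / 2 : ℝ) • (gainMatrix P s w VH lam V p).diag)) (Set.Ici 0) p := by
  have hsL := memLp_two_of_second_moment hs h2
  have hφ : Measurable fun v : Fin K → ℝ => Vᵀ *ᵥ v := measurable_mulVec _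
  have : IsProbabilityMeasure (P.map s) := Measure.isProbabilityMeasure_map hs.aemeasurable
  have : IsProbabilityMeasure ((P.map s).map fun v => Vᵀ *ᵥ v) :=
    Measure.isProbabilityMeasure_map hφ.aemeasurable
  have h2' : ∀ k, Integrable (fun u => u k ^ 2) ((P.map s).map fun v => Vᵀ *ᵥ v) := fun k => by
    rw [Measure.map_map hφ hs, integrable_map_measure
      ((measurable_pi_apply k).pow_const 2).aestronglyMeasurable (hφ.comp hs).aemeasurable]
    exact (memLp_mulVec hsL Vᵀ k).integrable_sq
  have hE := hasFDerivWithinAt_mixEntropy hVH h2' (integrable_evidence_mul_log hVH h2') hlam hp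
  have hlin : HasFDerivWithinAt (fun q : Fin K → ℝ => ∑ k, lam k ^ 2 / 2 * q k)
      (rowMap fun k => lam k ^ 2 / 2) (Set.Ici 0) p := by
    have h3 := (rowMap fun k => lam k ^ 2 / 2).hasFDerivWithinAt (s := Set.Ici 0) (x := p)
    refine h3.congr_of_eventuallyEq (Filter.Eventually.of_forall fun q => ?_) ?_ <;>
      simp [rowMap]
  have h4 := (hlin.sub hE).congr (f₁ := rate P s w VH lam V)
    (fun q hq => (mutualInfo_received hs hw hlaw hind h2 hVH hV hq).2)
    (mutualInfo_received hs hw hlaw hind h2 hVH hV hp).2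
  convert! h4 using 1
  simp only [rowMap, ← Finset.sum_sub_distrib, ← sub_smul]
  refine Finset.sum_congr rfl fun k _ => ?_
  simp only [Pi.smul_apply, Matrix.diag_apply, smul_eq_mul]
  rw [gainMatrix_diag hs hw hlaw hind h2 hVH hV]
  congr 1
  ring

/-- The entry is `lam_k²` times a mean square error. The optimality argument uses the sign because
its marginal levels have `0` as a floor. -/
lemma gainMatrix_diag_nonneg (hs : Measurable s) (hw : Measurable w)
    (hlaw : P.map w = stdGaussianPi nR) (hind : IndepFun s w P)
    (h2 : ∀ k l, ∫ ω, s ω k * s ω l ∂P = if k = l then 1 else 0)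
    (hVH : VHᵀ * VH = 1) (hV : Vᵀ * V = 1) (p : Fin K → ℝ) (k : Fin K) :
    0 ≤ gainMatrix P s w VH lam V p k k := by
  have hsL := memLp_two_of_second_moment hs h2
  have hφ : Measurable fun v : Fin K → ℝ => Vᵀ *ᵥ v := measurable_mulVec _
  have : IsProbabilityMeasure (P.map s) := Measure.isProbabilityMeasure_map hs.aemeasurable
  have hYm := measurable_output (A := VH) (a := fun k => lam k * Real.sqrt (p k)) hs hw hφ
  rw [gainMatrix_diag hs hw hlaw hind h2 hVH hV, ← integral_mulVec_sq hs h2 hV k,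
    ← integral_condExp_output_sq hVH hs hw hlaw hind hφ
      ((memLp_mulVec hsL Vᵀ k).integrable (by norm_num)),
    ← integral_sub_condExp_sq hYm.comap_le (memLp_mulVec hsL Vᵀ k)]
  exact mul_nonneg (sq_nonneg _) (integral_nonneg fun ω => sq_nonneg _)

end Rate

/-! ### Stationarity of the Lagrangian -/

section Allocation

variable {J N K : ℕ} {e : Fin J → Fin N}

lemma rowMap_apply (a x : Fin K → ℝ) : rowMap a x = ∑ k, a k * x k := by
  simp [rowMap]

lemma eq_of_mem_pool {i j : Fin J} {n : Fin N} (hi : n ∈ pool e i) (hj : n ∈ pool e j) : i = j := by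
  simp only [pool, Finset.mem_filter, Finset.mem_univ, true_and] at hi hj
  by_contra hne
  rcases lt_or_gt_of_ne hne with h | h
  · exact absurd (hi.2 j h) (not_lt.2 hj.1)
  · exact absurd (hj.2 i h) (not_lt.2 hi.1)

lemma sum_pool_ite {j : Fin J} {n : Fin N} (hn : n ∈ pool e j) (s : Finset (Fin J)) (c : ℝ) :
    ∑ i ∈ s, ∑ m ∈ pool e i, (if m = n then c else 0) = if j ∈ s then c else 0 := by
  have : ∀ i ∈ s, ∑ m ∈ pool e i, (if m = n then c else 0) = if i = j then c else 0 := by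
    intro i _
    rw [Finset.sum_ite_eq']
    by_cases hij : i = j
    · rw [if_pos hij, if_pos (hij ▸ hn)]
    · rw [if_neg hij, if_neg fun h => hij (eq_of_mem_pool h hn)]
  rw [Finset.sum_congr rfl this, Finset.sum_ite_eq']

/-- Pools are disjoint, so a change at channel use `n` is counted exactly once, in its own pool. -/
lemma sum_pool_update {j : Fin J} {n : Fin N} (hn : n ∈ pool e j) (s : Finset (Fin J))
    (f : Fin N → (Fin K → ℝ) → ℝ) (p : Fin N → Fin K → ℝ) (q : Fin K → ℝ) :
    ∑ i ∈ s, ∑ m ∈ pool e i, f m (Function.update p n q m)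
      = ∑ i ∈ s, ∑ m ∈ pool e i, f m (p m) + if j ∈ s then f n q - f n (p n) else 0 := by
  rw [← sum_pool_ite hn s, ← Finset.sum_add_distrib]
  refine Finset.sum_congr rfl fun i _ => ?_
  rw [← Finset.sum_add_distrib]
  refine Finset.sum_congr rfl fun m _ => ?_
  by_cases hm : m = n
  · subst hm; simp
  · simp [hm]

/-- Power spent in pool `j` counts in the cumulative constraints `l ≥ j` and in no earlier one,
whence the sum of multipliers over `Finset.Ici j`. -/
lemma lagrangian_update {j : Fin J} {n : Fin N} (hn : n ∈ pool e j) (Ts : ℝ) (E : Fin J → ℝ)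
    (I : Fin N → (Fin K → ℝ) → ℝ) (ρ : Fin J → ℝ) (p : Fin N → Fin K → ℝ) (q : Fin K → ℝ) :
    lagrangian e Ts E I ρ (Function.update p n q)
      = lagrangian e Ts E I ρ p + (I n q - I n (p n))
        - (Ts * ∑ l ∈ Finset.Ici j, ρ l) * (∑ k, q k - ∑ k, p n k) := by
  have hspent : ∀ l, spent e Ts (Function.update p n q) l
      = spent e Ts p l + if l ∈ Finset.Ici j then Ts * (∑ k, q k - ∑ k, p n k) else 0 := fun l => by
    rw [spent, spent, sum_pool_update hn _ fun _ v => ∑ k, v k, mul_add, mul_ite, mul_zero]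
    simp only [Finset.mem_Iic, Finset.mem_Ici]
  have hrate : totalRate e I (Function.update p n q) = totalRate e I p + (I n q - I n (p n)) := by
    rw [totalRate, totalRate, sum_pool_update hn, if_pos (Finset.mem_univ j)]
  have hterm : ∀ l, ρ l * (spent e Ts (Function.update p n q) l - harvested E l)
      = ρ l * (spent e Ts p l - harvested E l)
        + if l ∈ Finset.Ici j then ρ l * (Ts * (∑ k, q k - ∑ k, p n k)) else 0 := fun l => by
    rw [hspent]; split_ifs <;> ring
  simp only [lagrangian, hrate, hterm, Finset.sum_add_distrib]
  rw [Finset.sum_ite_mem, Finset.univ_inter, ← Finset.sum_mul]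
  ring

/-- The orthant is convex with nonempty interior, so relative derivatives are unique even where
components of `p` vanish. -/
lemma uniqueDiffWithinAt_Ici_pi {p : Fin K → ℝ} (hp : ∀ k, 0 ≤ p k) :
    UniqueDiffWithinAt ℝ (Set.Ici (0 : Fin K → ℝ)) p := by
  refine uniqueDiffWithinAt_convex (convex_Ici 0) ⟨1, ?_⟩ (subset_closure hp)
  exact mem_interior_iff_mem_nhds.2 (pi_Ici_mem_nhds fun _ => zero_lt_one)

/-- `1 / (1 / x) = x` holds at `x = 0` too, so the convention for an infinite water level needs no
separate case. -/
lemma one_div_waterLevel (Ts : ℝ) (ρ : Fin J → ℝ) (j : Fin J) :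
    1 / waterLevel Ts ρ j = 2 * Ts * ∑ l ∈ Finset.Ici j, ρ l := one_div_one_div _

lemma hasFDerivWithinAt_lagrangian_iff {j : Fin J} {n : Fin N} (hn : n ∈ pool e j) (Ts : ℝ)
    (E : Fin J → ℝ) (I : Fin N → (Fin K → ℝ) → ℝ) (ρ : Fin J → ℝ) (p : Fin N → Fin K → ℝ)
    (hp : ∀ k, 0 ≤ p n k) {D : Fin K → ℝ}
    (hI : HasFDerivWithinAt (I n) (rowMap ((1 / 2 : ℝ) • D)) (Set.Ici 0) (p n)) :
    HasFDerivWithinAt (fun q : Fin K → ℝ => lagrangian e Ts E I ρ (Function.update p n q))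
      (0 : (Fin K → ℝ) →L[ℝ] ℝ) (Set.Ici 0) (p n) ↔ ∀ k, D k = 1 / waterLevel Ts ρ j := by
  set c := Ts * ∑ l ∈ Finset.Ici j, ρ l with hc
  have hsum : HasFDerivWithinAt (fun q : Fin K → ℝ => ∑ k, q k) (rowMap fun _ => 1)
      (Set.Ici 0) (p n) := by
    refine (rowMap fun _ => 1).hasFDerivWithinAt.congr (fun q _ => ?_) ?_ <;> simp [rowMap_apply]
  have hL : HasFDerivWithinAt (fun q : Fin K → ℝ => lagrangian e Ts E I ρ (Function.update p n q))
      (rowMap ((1 / 2 : ℝ) • D) - c • rowMap fun _ => 1) (Set.Ici 0) (p n) := by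
    simp_rw [lagrangian_update hn]
    exact ((hI.sub_const _).const_add _).sub ((hsum.sub_const _).const_mul c)
  have hD : ∀ k, (D k = 1 / waterLevel Ts ρ j ↔ 1 / 2 * D k - c = 0) := fun k => by
    rw [one_div_waterLevel, hc, sub_eq_zero]
    constructor <;> intro h <;> linarith
  constructor
  · intro h k
    -- By uniqueness the computed derivative is zero; testing it on basis vectors isolates the
    -- components.
    have heq := (uniqueDiffWithinAt_Ici_pi hp).eq hL h
    have hk := DFunLike.congr_fun heq (Pi.single k 1)
    rw [hD]
    simpa [rowMap_apply, Pi.single_apply] using hk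
  · intro h
    convert! hL using 1
    ext x
    simp only [zero_apply, sub_apply, smul_apply, rowMap_apply,
      smul_eq_mul, Pi.smul_apply, Finset.mul_sum, ← Finset.sum_sub_distrib]
    refine (Finset.sum_eq_zero fun k _ => ?_).symm
    have := (hD k).1 (h k)
    linear_combination x k * this

/-! ### Optimal power allocations -/

lemma convex_feasible (Ts : ℝ) (E : Fin J → ℝ) : Convex ℝ (feasible K e Ts E) := by
  intro p hp q hq a b ha hb hab
  refine ⟨fun n k => ?_, fun l => ?_⟩
  · exact add_nonneg (mul_nonneg ha (hp.1 n k)) (mul_nonneg hb (hq.1 n k))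
  · have h : spent e Ts (a • p + b • q) l = a * spent e Ts p l + b * spent e Ts q l := by
      simp only [spent, Pi.add_apply, Pi.smul_apply, smul_eq_mul, Finset.sum_add_distrib,
        ← Finset.mul_sum]
      ring
    rw [h]
    calc _ ≤ a * harvested E l + b * harvested E l :=
          add_le_add (mul_le_mul_of_nonneg_left (hp.2 l) ha) (mul_le_mul_of_nonneg_left (hq.2 l) hb)
      _ = harvested E l := by rw [← add_mul, hab, one_mul]

/-- The variational inequality at an optimal allocation. -/
lemma sum_mul_sub_nonpos_of_isMaxOn {Ts : ℝ} {E : Fin J → ℝ} {I : Fin N → (Fin K → ℝ) → ℝ}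
    {p : Fin N → Fin K → ℝ} (hp : p ∈ feasible K e Ts E)
    (hmax : IsMaxOn (totalRate e I) (feasible K e Ts E) p) {D : Fin N → Fin K → ℝ}
    (hI : ∀ n, HasFDerivWithinAt (I n) (rowMap ((1 / 2 : ℝ) • D n)) (Set.Ici 0) (p n))
    {q : Fin N → Fin K → ℝ} (hq : q ∈ feasible K e Ts E) :
    ∑ j, ∑ n ∈ pool e j, ∑ k, D n k * (q n k - p n k) ≤ 0 := by
  have hd : HasFDerivWithinAt (totalRate e I) (∑ j, ∑ n ∈ pool e j,
      (rowMap ((1 / 2 : ℝ) • D n)).comp (ContinuousLinearMap.proj (R := ℝ) n))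
      (feasible K e Ts E) p := by
    unfold totalRate
    refine HasFDerivWithinAt.fun_sum fun j _ => HasFDerivWithinAt.fun_sum fun n _ => ?_
    refine (hI n).comp (t := Set.Ici 0) p
      (ContinuousLinearMap.proj (R := ℝ) (φ := fun _ : Fin N => Fin K → ℝ) n).hasFDerivWithinAt ?_
    exact fun r hr => hr.1 n
  -- Convexity of the feasible set makes every direction towards a feasible point tangent, so the
  -- first-order condition holds without concavity of the rate.
  have htan : q - p ∈ posTangentConeAt (feasible K e Ts E) p := by
    refine mem_posTangentConeAt_of_segment_subset ?_
    rw [add_sub_cancel]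
    exact (convex_feasible Ts E).segment_subset hp hq
  have h := hmax.localize.hasFDerivWithinAt_nonpos hd htan
  simp only [sum_apply, ContinuousLinearMap.comp_apply,
    ContinuousLinearMap.proj_apply, rowMap_apply, Pi.smul_apply, smul_eq_mul, Pi.sub_apply,
    mul_assoc, ← Finset.mul_sum] at h
  linarith

/-- The allocation of one unit of power to the component `k` of channel use `n`. -/
def unitPower (n : Fin N) (k : Fin K) : Fin N → Fin K → ℝ :=
  fun m c => if m = n then (if c = k then 1 else 0) else 0

lemma sum_pool_mul_unitPower {j : Fin J} {n : Fin N} (hn : n ∈ pool e j) (k : Fin K)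
    (s : Finset (Fin J)) (D : Fin N → Fin K → ℝ) :
    ∑ i ∈ s, ∑ m ∈ pool e i, ∑ c, D m c * unitPower n k m c = if j ∈ s then D n k else 0 := by
  rw [← sum_pool_ite hn s]
  refine Finset.sum_congr rfl fun i _ => Finset.sum_congr rfl fun m _ => ?_
  by_cases hm : m = n
  · subst hm; simp [unitPower]
  · simp [unitPower, hm]

lemma spent_add_unitPower {i j : Fin J} {m n : Fin N} (hm : m ∈ pool e i) (hn : n ∈ pool e j)
    (c k : Fin K) (Ts t θ : ℝ) (p : Fin N → Fin K → ℝ) (l : Fin J) :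
    spent e Ts (fun r x => p r x + t * (unitPower m c r x - θ * unitPower n k r x)) l
      = spent e Ts p l + Ts * t * ((if i ≤ l then 1 else 0) - θ * if j ≤ l then 1 else 0) := by
  have h1 := sum_pool_mul_unitPower hm c (Finset.Iic l) fun _ _ => 1
  have h2 := sum_pool_mul_unitPower hn k (Finset.Iic l) fun _ _ => 1
  simp only [one_mul, Finset.mem_Iic] at h1 h2
  rw [spent, spent, ← h1, ← h2]
  simp only [Finset.sum_add_distrib, ← Finset.mul_sum, Finset.sum_sub_distrib]
  ring

/-- At an optimal allocation, power can be moved from `(n, k)` to `(m, c)` (if `θ = 1`), or added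
to `(m, c)` (if `θ = 0`), only at a loss, unless an active constraint forbids it. -/
lemma le_mul_of_isMaxOn {Ts : ℝ} (hTs : 0 < Ts) {E : Fin J → ℝ} {I : Fin N → (Fin K → ℝ) → ℝ}
    {p : Fin N → Fin K → ℝ} (hp : p ∈ feasible K e Ts E)
    (hmax : IsMaxOn (totalRate e I) (feasible K e Ts E) p) {D : Fin N → Fin K → ℝ}
    (hI : ∀ n, HasFDerivWithinAt (I n) (rowMap ((1 / 2 : ℝ) • D n)) (Set.Ici 0) (p n))
    {i j : Fin J} {m n : Fin N} (hm : m ∈ pool e i) (hn : n ∈ pool e j) (c k : Fin K) {θ : ℝ}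
    (hθ0 : 0 ≤ θ) (hθ : θ ≠ 0 → 0 < p n k)
    (hact : ∀ l, i ≤ l → 1 - θ * (if j ≤ l then 1 else 0) ≤ 0 ∨ spent e Ts p l < harvested E l) :
    D m c ≤ θ * D n k := by
  -- The step `t` is small enough to keep the donor component nonnegative and not to overshoot any
  -- constraint that has slack.
  obtain ⟨t, ht, htp, htl⟩ : ∃ t : ℝ, 0 < t ∧ t * θ ≤ p n k ∧
      ∀ l, spent e Ts p l < harvested E l → spent e Ts p l + Ts * t ≤ harvested E l := by
    have h1 : ∀ᶠ t in nhdsWithin (0 : ℝ) (Set.Ioi 0), t * θ ≤ p n k := by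
      rcases eq_or_ne θ 0 with h | h
      · simp [h, hp.1 n k]
      · have : Filter.Tendsto (fun t : ℝ => t * θ) (nhdsWithin 0 (Set.Ioi 0)) (nhds (0 * θ)) :=
          ((continuous_id.mul continuous_const).tendsto 0).mono_left nhdsWithin_le_nhds
        rw [zero_mul] at this
        exact (this.eventually (gt_mem_nhds (hθ h))).mono fun t => le_of_lt
    have h2 : ∀ᶠ t in nhdsWithin (0 : ℝ) (Set.Ioi 0), ∀ l, spent e Ts p l < harvested E l →
        spent e Ts p l + Ts * t ≤ harvested E l := by
      refine Filter.eventually_all.2 fun l => ?_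
      by_cases hl : spent e Ts p l < harvested E l
      · have : Filter.Tendsto (fun t : ℝ => spent e Ts p l + Ts * t) (nhdsWithin 0 (Set.Ioi 0))
            (nhds (spent e Ts p l + Ts * 0)) :=
          (Continuous.tendsto (by fun_prop) 0).mono_left nhdsWithin_le_nhds
        rw [mul_zero, add_zero] at this
        exact (this.eventually (gt_mem_nhds hl)).mono fun t ht _ => ht.le
      · exact Filter.Eventually.of_forall fun t h => absurd h hl
    obtain ⟨t, ⟨h1, h2⟩, h3⟩ := ((h1.and h2).and self_mem_nhdsWithin).exists
    exact ⟨t, h3, h1, h2⟩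
  have hq : (fun r x => p r x + t * (unitPower m c r x - θ * unitPower n k r x))
      ∈ feasible K e Ts E := by
    refine ⟨fun r x => ?_, fun l => ?_⟩
    · have h1 : 0 ≤ unitPower m c r x := by unfold unitPower; split_ifs <;> norm_num
      have h2 : t * (θ * unitPower n k r x) ≤ p r x := by
        unfold unitPower
        split_ifs with h h'
        · rw [h, h', mul_one]; exact htp
        · simpa using hp.1 r x
        · simpa using hp.1 r x
      have h3 := mul_nonneg ht.le h1
      linarith
    · rw [spent_add_unitPower hm hn]
      have hTt : 0 < Ts * t := mul_pos hTs ht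
      have hj : 0 ≤ θ * (if j ≤ l then 1 else 0) := mul_nonneg hθ0 (by split_ifs <;> norm_num)
      have h0 := hp.2 l
      -- A constraint before the receiving pool can only be relaxed. From there on, either the
      -- removed power compensates the added power, or the constraint has slack.
      by_cases hil : i ≤ l
      · rw [if_pos hil]
        rcases hact l hil with h | h
        · nlinarith
        · have := htl l h
          nlinarith
      · rw [if_neg hil]
        nlinarith
  have h := sum_mul_sub_nonpos_of_isMaxOn hp hmax hI hq
  have hm' := sum_pool_mul_unitPower hm c Finset.univ D
  have hn' := sum_pool_mul_unitPower hn k Finset.univ D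
  rw [if_pos (Finset.mem_univ _)] at hm' hn'
  have e1 : ∀ r x, D r x * (p r x + t * (unitPower m c r x - θ * unitPower n k r x) - p r x)
      = t * (D r x * unitPower m c r x) - t * θ * (D r x * unitPower n k r x) := fun r x => by ring
  simp only [e1, Finset.sum_sub_distrib, ← Finset.mul_sum] at h
  rw [hm', hn'] at h
  have : t * (D m c - θ * D n k) ≤ 0 := by linarith
  nlinarith [nonpos_of_mul_nonpos_right this ht]

/-! ### Construction of the multipliers. -/

/-- The largest marginal rate at the components that can receive the energy that is available at
the beginning of pool `j`, when the constraints `act` are active. -/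
noncomputable def marginalLevel (e : Fin J → Fin N) (D : Fin N → Fin K → ℝ) (act : Set (Fin J))
    (j : ℕ) : ℝ := by
  classical
  exact ⨆ x : Fin N × Fin K,
    if ∃ i, x.1 ∈ pool e i ∧ ∀ l, i ≤ l → (l : ℕ) < j → l ∉ act then D x.1 x.2 else 0

/-- The hypothesis `0 ≤ r` covers the value `0` given to components that cannot be reached, and the
supremum of an empty family. -/
lemma marginalLevel_le {D : Fin N → Fin K → ℝ} {act : Set (Fin J)} {j : ℕ} {r : ℝ} (hr : 0 ≤ r)
    (h : ∀ m c i, m ∈ pool e i → (∀ l, i ≤ l → (l : ℕ) < j → l ∉ act) → D m c ≤ r) :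
    marginalLevel e D act j ≤ r := by
  refine Real.iSup_le (fun x => ?_) hr
  split_ifs with hx
  · obtain ⟨i, hi, hl⟩ := hx
    exact h _ _ i hi hl
  · exact hr

lemma le_marginalLevel {D : Fin N → Fin K → ℝ} {act : Set (Fin J)} {j : ℕ} {m : Fin N} (c : Fin K)
    {i : Fin J} (hm : m ∈ pool e i) (hl : ∀ l, i ≤ l → (l : ℕ) < j → l ∉ act) :
    D m c ≤ marginalLevel e D act j := by
  classical
  unfold marginalLevel
  refine le_trans (le_of_eq ?_) (le_ciSup (Set.finite_range _).bddAbove (m, c))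
  rw [if_pos ⟨i, hm, hl⟩]

lemma marginalLevel_nonneg {D : Fin N → Fin K → ℝ} (hD : ∀ n k, 0 ≤ D n k) (act : Set (Fin J))
    (j : ℕ) : 0 ≤ marginalLevel e D act j := by
  refine Real.iSup_nonneg fun x => ?_
  split_ifs
  · exact hD _ _
  · exact le_rfl

lemma sum_Ici_sub (R : ℕ → ℝ) (j : Fin J) :
    ∑ l ∈ Finset.Ici j, (R l - R (l + 1)) = R j - R J := by
  have h : ∑ l ∈ Finset.Ici j, (R l - R (l + 1)) = ∑ l ∈ Finset.Ico (j : ℕ) J, (R l - R (l + 1)) := by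
    rw [← Fin.map_valEmbedding_Ici, Finset.sum_map]
    rfl
  rw [h]
  have := Finset.sum_Ico_sub R j.2.le
  rw [← neg_inj, ← Finset.sum_neg_distrib]
  simpa using this

/-- The Karush-Kuhn-Tucker conditions at an optimal allocation. -/
lemma exists_multipliers {Ts : ℝ} (hTs : 0 < Ts) {E : Fin J → ℝ} {I : Fin N → (Fin K → ℝ) → ℝ}
    {p : Fin N → Fin K → ℝ} (hp : p ∈ feasible K e Ts E)
    (hmax : IsMaxOn (totalRate e I) (feasible K e Ts E) p) {D : Fin N → Fin K → ℝ}
    (hD : ∀ n k, 0 ≤ D n k)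
    (hI : ∀ n, HasFDerivWithinAt (I n) (rowMap ((1 / 2 : ℝ) • D n)) (Set.Ici 0) (p n)) :
    ∃ ρ : Fin J → ℝ, (∀ l, 0 ≤ ρ l) ∧
      (∀ l, ρ l * (spent e Ts p l - harvested E l) = 0) ∧
      ∀ j, ∀ n ∈ pool e j, ∀ k, D n k ≤ 1 / waterLevel Ts ρ j ∧
        (0 < p n k → D n k = 1 / waterLevel Ts ρ j) := by
  set act : Set (Fin J) := {l | spent e Ts p l = harvested E l} with hact
  have hslack : ∀ l, l ∉ act → spent e Ts p l < harvested E l := fun l hl =>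
    lt_of_le_of_ne (hp.2 l) hl
  set R := marginalLevel e D act with hR
  -- Index `J` lies past the last constraint: a component reached from there meets only slack
  -- constraints, so power can be added to it outright (`θ = 0`) and its marginal rate is at most
  -- `0`.
  have hRJ : R J = 0 := by
    refine le_antisymm (marginalLevel_le le_rfl fun m c i hm hl => ?_)
      (marginalLevel_nonneg hD act J)
    have := le_mul_of_isMaxOn hTs hp hmax hI hm hm c c (θ := 0) le_rfl (fun h => absurd rfl h)
      fun l hil => Or.inr (hslack l (hl l hil l.2))
    simpa using this
  -- Raising the index adds constraints that must be inactive, so fewer components are reached.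
  have hanti : ∀ l : Fin J, R (l + 1) ≤ R l := fun l =>
    marginalLevel_le (marginalLevel_nonneg hD act l) fun m c i hm hl =>
      le_marginalLevel c hm fun l' h1 h2 => hl l' h1 (by omega)
  -- An inactive constraint excludes no component; this gives complementary slackness.
  have hconst : ∀ l : Fin J, l ∉ act → R l = R (l + 1) := fun l hla =>
    le_antisymm (marginalLevel_le (marginalLevel_nonneg hD act _) fun m c i hm hl =>
      le_marginalLevel c hm fun l' h1 h2 => by
        rcases (Nat.lt_succ_iff_lt_or_eq.1 h2) with h | h
        · exact hl l' h1 h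
        · rwa [Fin.ext h]) (hanti l)
  set ρ : Fin J → ℝ := fun l => (R l - R (l + 1)) / (2 * Ts) with hρ
  -- The sum over `l ≥ j` telescopes to `R j - R J = R j`.
  have hW : ∀ j, 1 / waterLevel Ts ρ j = R j := fun j => by
    rw [one_div_waterLevel, hρ, ← Finset.sum_div, sum_Ici_sub, hRJ]
    field_simp
    ring
  refine ⟨ρ, fun l => div_nonneg (sub_nonneg.2 (hanti l)) (by linarith), fun l => ?_, ?_⟩
  · by_cases hl : l ∈ act
    · rw [show spent e Ts p l = harvested E l from hl, sub_self, mul_zero]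
    · simp [hρ, ← hconst l hl]
  · intro j n hn k
    have h1 : D n k ≤ R j := le_marginalLevel k hn fun l h h' => absurd h (not_le.2 h')
    rw [hW]
    -- A component with positive power can give some of it (`θ = 1`) to any component counted in `R
    -- j`: from `j` on the transfer balances, and before `j` only slack constraints are affected.
    -- Hence none of these has a larger marginal rate.
    refine ⟨h1, fun hpos => le_antisymm h1 (marginalLevel_le (hD n k) fun m c i hm hl => ?_)⟩
    have := le_mul_of_isMaxOn hTs hp hmax hI hm hn c k (θ := 1) zero_le_one (fun _ => hpos)
      fun l hil => by
        by_cases hjl : j ≤ l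
        · left; simp [hjl]
        · right; exact hslack l (hl l hil (not_le.1 hjl))
    simpa using this

end Allocation

theorem mainTheorem4 {Ω : Type*} [MeasurableSpace Ω] (P : Measure Ω) [IsProbabilityMeasure P]
    {N J K nR nT : ℕ}
    -- symbols and noise
    (S : Fin N → Ω → Fin K → ℝ) (W : Fin N → Ω → Fin nR → ℝ)
    (hSW : IsSymbolNoiseModel P S W)
    -- full-rank channels and their singular value decompositions
    (H : Fin N → Matrix (Fin nR) (Fin nT) ℝ)
    (hK : K = min nT nR) (hrank : ∀ n, (H n).rank = K)
    (VH : Fin N → Matrix (Fin nR) (Fin K) ℝ) (lam : Fin N → Fin K → ℝ)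
    (UH : Fin N → Matrix (Fin nT) (Fin K) ℝ)
    (hSVD : ∀ n, IsThinSVD (H n) (VH n) (lam n) (UH n))
    -- right singular vectors of the precoders
    (V : Fin N → Matrix (Fin K) (Fin K) ℝ)
    (hV : ∀ n, V n ∈ Matrix.orthogonalGroup (Fin K) ℝ)
    -- energy arrivals, the first one at the first channel use
    (e : Fin J → Fin N) (he : StrictMono e) (hJ : 0 < J) (he0 : (e ⟨0, hJ⟩ : ℕ) = 0)
    (E : Fin J → ℝ) (hE : ∀ j, 0 ≤ E j) (Ts : ℝ) (hTs : 0 < Ts) :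
    -- the Jacobian of the mutual information, which is finite
    (∀ n, ∀ p : Fin K → ℝ, (∀ k, 0 ≤ p k) →
      mutualInfo P (S n) (received (S n) (W n) (effChannel (VH n) (lam n) (V n) p)) ≠ ∞ ∧
      HasFDerivWithinAt (rate P (S n) (W n) (VH n) (lam n) (V n))
        (rowMap ((1 / 2 : ℝ) •
          (gainMatrix P (S n) (W n) (VH n) (lam n) (V n) p).diag)) (Set.Ici 0) p ∧
      ((∀ k, 0 < p k) →
        HasFDerivAt (rate P (S n) (W n) (VH n) (lam n) (V n))
          (rowMap ((1 / 2 : ℝ) •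
            (gainMatrix P (S n) (W n) (VH n) (lam n) (V n) p).diag)) p)) ∧
    -- the stationarity condition of the Lagrangian
    (∀ ρ : Fin J → ℝ, ∀ p : Fin N → Fin K → ℝ, (∀ n k, 0 ≤ p n k) →
      ∀ j, ∀ n ∈ pool e j,
        (HasFDerivWithinAt
          (fun q : Fin K → ℝ => lagrangian e Ts E
            (fun m => rate P (S m) (W m) (VH m) (lam m) (V m)) ρ (Function.update p n q))
          (0 : (Fin K → ℝ) →L[ℝ] ℝ) (Set.Ici 0) (p n) ↔
        ∀ k, gainMatrix P (S n) (W n) (VH n) (lam n) (V n) (p n) k k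
          = 1 / waterLevel Ts ρ j)) ∧
    -- the KKT relation at an optimal power allocation
    (∀ p ∈ feasible K e Ts E,
      IsMaxOn (totalRate e fun m => rate P (S m) (W m) (VH m) (lam m) (V m))
        (feasible K e Ts E) p →
      ∃ ρ : Fin J → ℝ, (∀ l, 0 ≤ ρ l) ∧
        (∀ l, ρ l * (spent e Ts p l - harvested E l) = 0) ∧
        ∀ j, ∀ n ∈ pool e j, ∀ k,
          gainMatrix P (S n) (W n) (VH n) (lam n) (V n) (p n) k k ≤ 1 / waterLevel Ts ρ j ∧
          (0 < p n k →
            gainMatrix P (S n) (W n) (VH n) (lam n) (V n) (p n) k k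
              = 1 / waterLevel Ts ρ j)) := by
  have hVt : ∀ n, (V n)ᵀ * V n = 1 := fun n => (Matrix.mem_orthogonalGroup_iff' _ _).1 (hV n)
  have hrate : ∀ n, ∀ p : Fin K → ℝ, (∀ k, 0 ≤ p k) →
      HasFDerivWithinAt (rate P (S n) (W n) (VH n) (lam n) (V n)) (rowMap ((1 / 2 : ℝ) •
        (gainMatrix P (S n) (W n) (VH n) (lam n) (V n) p).diag)) (Set.Ici 0) p := fun n p hp =>
    hasFDerivWithinAt_rate (hSW.measurable_symbol n) (hSW.measurable_noise n) (hSW.noise_law n)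
      (hSW.indep_noise n) (hSW.second_moment n) (hSVD n).left_semiunitary (hVt n) (hSVD n).nonneg hp
  refine ⟨fun n p hp => ⟨?_, hrate n p hp, fun hpos => ?_⟩, fun ρ p hp j n hn => ?_,
    fun p hp hmax => ?_⟩
  · exact (mutualInfo_received (hSW.measurable_symbol n) (hSW.measurable_noise n)
      (hSW.noise_law n) (hSW.indep_noise n) (hSW.second_moment n) (hSVD n).left_semiunitary
      (hVt n) hp).1
  -- A point with positive components has the orthant as a neighbourhood.
  · exact (hrate n p hp).hasFDerivAt (pi_Ici_mem_nhds hpos)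
  · exact hasFDerivWithinAt_lagrangian_iff hn Ts E
      (fun m => rate P (S m) (W m) (VH m) (lam m) (V m)) ρ p (hp n) (hrate n (p n) (hp n))
  · exact exists_multipliers hTs hp hmax
      (fun n k => gainMatrix_diag_nonneg (hSW.measurable_symbol n) (hSW.measurable_noise n)
        (hSW.noise_law n) (hSW.indep_noise n) (hSW.second_moment n) (hSVD n).left_semiunitary
        (hVt n) (p n) k)
      fun n => hrate n (p n) (hp.1 n)
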